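/- Let $(X,\mu)$ be a standard probability space, i.e. a standard Borel space with a non-atomic Borel probability measure, and let $\mathrm{Aut}(X,\mu)$ be the group of Borel bijections $T:X\to X$ preserving $\mu$, two of them being identified when they coincide almost everywhere. A graphing $\Phi$ on $(X,\mu)$ is a countable set of partial isomorphisms, i.e. of measure-preserving Borel bijections $\varphi:\mathrm{dom}\,\varphi\to\mathrm{rng}\,\varphi$ between Borel subsets of $X$. Let $\mathcal R_\Phi$ be the equivalence relation generated by the pairs $(x,\varphi(x))$, $\varphi\in\Phi$, $x\in\mathrm{dom}\,\varphi$; its classes are the $\Phi$-orbits, and $d_\Phi$ denotes the path metric on the $\Phi$-orbits: $d_\Phi(x,y)$ is the least $n$ such that $y=\varphi_n\cdots\varphi_1(x)$ with $\varphi_1,\dots,\varphi_n\in\Phi\cup\Phi^{-1}$. The graphing is aperiodic if almost all $\Phi$-orbits are infinite, a set is $\Phi$-invariant if it is a union of $\Phi$-orbits, and $\Phi$ is ergodic if for every Borel set $A$ with $\mu(A)>0$ the union of the $\Phi$-orbits meeting $A$ has full measure. The $\mathrm L^1$ full group $[\Phi]_1$ is the group of all $T\in\mathrm{Aut}(X,\mu)$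 such that $T(x)\,\mathcal R_\Phi\,x$ for almost every $x$ and $\int_X d_\Phi(x,T(x))\,d\mu(x)<+\infty$, with the group topology given by the metric $\tilde d_\Phi(S,T)=\int_X d_\Phi(S(x),T(x))\,d\mu(x)$. Let $\overline{D([\Phi]_1)}$ be the closure of its derived (commutator) subgroup in $[\Phi]_1$, and for a Borel set $A$ let $\overline{D([\Phi]_1)}_A$ be the subgroup of those $T\in\overline{D([\Phi]_1)}$ whose support $\{x: T(x)\neq x\}$ is contained in $A$ up to a null set. A topological group is topologically simple if it is nontrivial and its only closed normal subgroups are the trivial subgroup and the whole group. **Theorem.** 1. Let $\Phi$ be an aperiodic graphing. For every closed normal subgroup $N$ of $\overline{D([\Phi]_1)}$ there is a $\Phi$-invariant Borel set $A$, unique up to measure zero among $\Phi$-invariant Borel sets, such that $N=\overline{D([\Phi]_1)}_A$. 2. Let $\Phi$ be an aperiodic graphing. Then $\Phi$ is ergodic if and only if $\overline{D([\Phi]_1)}$ is topologically simple. 3. Let $T$ be a measure-preserving transformation of $(X,\mu)$, and let $[T]_1=[\{T\}]_1$. If $T$ is ergodic, then $\overline{D([T]_1)}$ is topologically simple. Conversely,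 if almost all $T$-orbits are infinite and $\overline{D([T]_1)}$ is topologically simple, then $T$ is ergodic. -/

import Mathlib

open Set Filter Topology MeasureTheory
open scoped ENNReal

namespace L1Full

variable {X : Type*} [MeasurableSpace X]

/-! ### The group of measure-preserving transformations -/

/-- Measure-preserving transformations, before identification modulo null sets: Borel bijections
`T : X → X` (with Borel inverse) preserving `μ`. -/
def PreAut (μ : Measure X) : Subgroup (Equiv.Perm X) where
  carrier := {T | MeasurePreserving T μ μ ∧ Measurable T.symm}
  mul_mem' := fun {S T} hS hT => ⟨hS.1.comp hT.1, hT.2.comp hS.2⟩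
  one_mem' := ⟨MeasurePreserving.id μ, measurable_id⟩
  inv_mem' := fun {T} hT => by
    let e : X ≃ᵐ X := ⟨T, hT.1.measurable, hT.2⟩
    have he : MeasurePreserving e μ μ := hT.1
    exact ⟨he.symm e, hT.1.measurable⟩

/-- The transformations which coincide with the identity almost everywhere. -/
def nullAut (μ : Measure X) : Subgroup (PreAut μ) where
  carrier := {T | ∀ᵐ x ∂μ, T.1 x = x}
  mul_mem' := fun {S T} hS hT => by
    have hS : ∀ᵐ x ∂μ, S.1 x = x := hS
    have hT : ∀ᵐ x ∂μ, T.1 x = x := hT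
    change ∀ᵐ x ∂μ, S.1 (T.1 x) = x
    filter_upwards [hS, hT] with x h1 h2
    rw [h2, h1]
  one_mem' := by
    change ∀ᵐ x ∂μ, x = x
    exact Eventually.of_forall fun _ => rfl
  inv_mem' := fun {T} hT => by
    have hT : ∀ᵐ x ∂μ, T.1 x = x := hT
    change ∀ᵐ x ∂μ, T.1.symm x = x
    filter_upwards [hT] with x h
    rw [Equiv.symm_apply_eq, h]

instance nullAut_normal (μ : Measure X) : (nullAut μ).Normal where
  conj_mem := fun T hT S => by
    have hT : ∀ᵐ x ∂μ, T.1 x = x := hT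
    change ∀ᵐ x ∂μ, S.1 (T.1 (S.1.symm x)) = x
    have hS : MeasurePreserving S.1.symm μ μ := (S⁻¹).2.1
    filter_upwards [hS.quasiMeasurePreserving.ae hT] with x h
    rw [h, Equiv.apply_symm_apply]

/-- `Aut(X, μ)`: measure-preserving transformations modulo equality almost everywhere. -/
abbrev Aut (μ : Measure X) : Type _ := PreAut μ ⧸ nullAut μ

lemma mk_eq_iff {μ : Measure X} (S T : PreAut μ) :
    (QuotientGroup.mk S : Aut μ) = QuotientGroup.mk T ↔ ∀ᵐ x ∂μ, S.1 x = T.1 x := by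
  rw [QuotientGroup.eq]
  change (∀ᵐ x ∂μ, S.1.symm (T.1 x) = x) ↔ _
  refine eventually_congr (Eventually.of_forall fun x => ?_)
  rw [Equiv.symm_apply_eq, eq_comm]

/-- The classes of transformations `T` whose support `{x | T x ≠ x}` is contained in `A`,
up to a null set. -/
def supportedIn (μ : Measure X) (A : Set X) : Subgroup (Aut μ) :=
  Subgroup.map (QuotientGroup.mk' (nullAut μ))
    { carrier := {T | ∀ᵐ x ∂μ, T.1 x ≠ x → x ∈ A}
      mul_mem' := fun {S T} hS hT => by
        have hS : ∀ᵐ x ∂μ, S.1 x ≠ x → x ∈ A := hS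
        have hT : ∀ᵐ x ∂μ, T.1 x ≠ x → x ∈ A := hT
        change ∀ᵐ x ∂μ, S.1 (T.1 x) ≠ x → x ∈ A
        filter_upwards [hS, hT] with x h1 h2 h
        by_cases hx : T.1 x = x
        · rw [hx] at h
          exact h1 h
        · exact h2 hx
      one_mem' := by
        change ∀ᵐ x ∂μ, x ≠ x → x ∈ A
        exact Eventually.of_forall fun x h => absurd rfl h
      inv_mem' := fun {T} hT => by
        have hT : ∀ᵐ x ∂μ, T.1 x ≠ x → x ∈ A := hT
        change ∀ᵐ x ∂μ, T.1.symm x ≠ x → x ∈ A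
        filter_upwards [hT] with x h h'
        refine h fun h2 => h' ?_
        rw [Equiv.symm_apply_eq, h2] }

/-! ### Graphings -/

/-- A partial isomorphism of `(X, μ)`: a Borel bijection between two Borel sets, preserving the
measures induced by `μ` on them. -/
structure PartialIso (μ : Measure X) where
  dom : Set X
  rng : Set X
  measurableSet_dom : MeasurableSet dom
  measurableSet_rng : MeasurableSet rng
  toEquiv : dom ≃ᵐ rng
  measurePreserving : MeasurePreserving toEquiv
    (Measure.comap Subtype.val μ) (Measure.comap Subtype.val μ)

/-- A graphing: a countable set of partial isomorphisms. -/
structure Graphing (μ : Measure X) where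
  carrier : Set (PartialIso μ)
  countable : carrier.Countable

namespace Graphing

variable {μ : Measure X}

/-- `Φ.rel x y`: `y = φ x` for some `φ ∈ Φ` with `x ∈ dom φ`. -/
def rel (Φ : Graphing μ) (x y : X) : Prop :=
  ∃ φ ∈ Φ.carrier, ∃ h : x ∈ φ.dom, (φ.toEquiv ⟨x, h⟩ : X) = y

/-- The equivalence relation generated by the graphing. -/
def orbitRel (Φ : Graphing μ) : Setoid X := Relation.EqvGen.setoid Φ.rel

/-- The graph on `X` whose (unoriented) edges are the pairs `(x, φ x)`; loops are irrelevant for the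
path metric. -/
def graph (Φ : Graphing μ) : SimpleGraph X := SimpleGraph.fromRel Φ.rel

/-- The path metric `d_Φ`, with value `∞` on pairs of points in different orbits. -/
noncomputable def d (Φ : Graphing μ) (x y : X) : ℝ≥0∞ := ((Φ.graph.edist x y : ℕ∞) : ℝ≥0∞)

/-- The orbits of almost all points are infinite. -/
def Aperiodic (Φ : Graphing μ) : Prop := ∀ᵐ x ∂μ, {y | Φ.orbitRel x y}.Infinite

/-- The `Φ`-closure of a set: the union of all the orbits which meet it. -/
def saturation (Φ : Graphing μ) (A : Set X) : Set X := {y | ∃ x ∈ A, Φ.orbitRel x y}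

/-- The closure of any non-null Borel set has full measure. -/
def IsErgodic (Φ : Graphing μ) : Prop :=
  ∀ A : Set X, MeasurableSet A → μ A ≠ 0 → ∀ᵐ x ∂μ, x ∈ Φ.saturation A

/-- A set is `Φ`-invariant when it is a union of orbits. -/
def Invariant (Φ : Graphing μ) (A : Set X) : Prop := ∀ x y, Φ.orbitRel x y → x ∈ A → y ∈ A

/-- The graphing `{T}`, where `T` is a measure-preserving transformation. -/
def single (T : X ≃ᵐ X) (hT : MeasurePreserving T μ μ) : Graphing μ where
  carrier := {{
    dom := univ
    rng := univ
    measurableSet_dom := MeasurableSet.univ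
    measurableSet_rng := MeasurableSet.univ
    toEquiv := (MeasurableEquiv.Set.univ X).trans (T.trans (MeasurableEquiv.Set.univ X).symm)
    measurePreserving := by
      refine ⟨MeasurableEquiv.measurable _, ?_⟩
      ext s hs
      rw [Measure.map_apply (MeasurableEquiv.measurable _) hs,
        comap_subtype_coe_apply MeasurableSet.univ,
        comap_subtype_coe_apply MeasurableSet.univ,
        ← hT.measure_preimage_equiv (Subtype.val '' s)]
      congr 1
      ext x
      simp only [mem_image, mem_preimage]
      constructor
      · rintro ⟨y, hy, rfl⟩
        exact ⟨_, hy, rfl⟩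
      · rintro ⟨y, hy, hyx⟩
        refine ⟨⟨x, mem_univ x⟩, ?_, rfl⟩
        have : y = ⟨T x, mem_univ _⟩ := Subtype.ext hyx
        rwa [this] at hy }}
  countable := countable_singleton _

/-! #### The path metric is measurable along measurable maps -/

lemma d_self (Φ : Graphing μ) (x : X) : Φ.d x x = 0 := by simp [d]

lemma d_comm (Φ : Graphing μ) (x y : X) : Φ.d x y = Φ.d y x := by
  simp only [d, SimpleGraph.edist_comm]

lemma d_triangle (Φ : Graphing μ) (x y z : X) : Φ.d x z ≤ Φ.d x y + Φ.d y z := by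
  simp only [d]
  rw [← ENat.toENNReal_add]
  exact ENat.toENNReal_le.2 SimpleGraph.edist_triangle

lemma d_eq_zero {Φ : Graphing μ} {x y : X} : Φ.d x y = 0 ↔ x = y := by
  simp [d]

lemma one_le_d {Φ : Graphing μ} {x y : X} (h : x ≠ y) : 1 ≤ Φ.d x y := by
  have : (1 : ℕ∞) ≤ Φ.graph.edist x y :=
    Order.one_le_iff_pos.2 (SimpleGraph.edist_pos_of_ne h)
  simpa [d] using ENat.toENNReal_le.2 this

lemma edist_le_succ_iff (Φ : Graphing μ) (x y : X) (n : ℕ) :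
    Φ.graph.edist x y ≤ (n + 1 : ℕ) ↔
      Φ.graph.edist x y ≤ n ∨ ∃ z, (Φ.rel x z ∨ Φ.rel z x) ∧ Φ.graph.edist z y ≤ n := by
  constructor
  · intro h
    have hne : Φ.graph.edist x y ≠ ⊤ := ne_top_of_le_ne_top (ENat.natCast_ne_top _) h
    obtain ⟨p, hp⟩ := SimpleGraph.exists_walk_of_edist_ne_top hne
    rw [← hp] at h ⊢
    cases p with
    | nil => left; simp
    | @cons _ z _ hadj q =>
      right
      refine ⟨z, ((SimpleGraph.fromRel_adj _ _ _).1 hadj).2, ?_⟩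
      refine (SimpleGraph.edist_le q).trans ?_
      have h' : q.length + 1 ≤ n + 1 := by exact_mod_cast h
      exact_mod_cast Nat.le_of_succ_le_succ h'
  · rintro (h | ⟨z, hz, h⟩)
    · exact h.trans (by exact_mod_cast Nat.le_succ n)
    · by_cases hxz : x = z
      · subst hxz
        exact h.trans (by exact_mod_cast Nat.le_succ n)
      · have hadj : Φ.graph.Adj x z := (SimpleGraph.fromRel_adj _ _ _).2 ⟨hxz, hz⟩
        calc Φ.graph.edist x y ≤ Φ.graph.edist x z + Φ.graph.edist z y :=
              SimpleGraph.edist_triangle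
          _ ≤ 1 + n := add_le_add (SimpleGraph.edist_eq_one_iff_adj.2 hadj).le h
          _ = (n + 1 : ℕ) := by push_cast; rw [add_comm]

open Classical in
lemma measurableSet_edist_le [StandardBorelSpace X] (Φ : Graphing μ) (n : ℕ) :
    ∀ f g : X → X, Measurable f → Measurable g →
      MeasurableSet {x | Φ.graph.edist (f x) (g x) ≤ n} := by
  let _ := upgradeStandardBorel X
  induction n with
  | zero =>
    intro f g hf hg
    simpa using measurableSet_eq_fun hf hg
  | succ n ih =>
    intro f g hf hg
    let F : PartialIso μ → X → X := fun φ x => if h : x ∈ φ.dom then φ.toEquiv ⟨x, h⟩ else x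
    let G : PartialIso μ → X → X := fun φ x => if h : x ∈ φ.rng then φ.toEquiv.symm ⟨x, h⟩ else x
    have hF : ∀ φ, Measurable (F φ) := fun φ =>
      Measurable.dite (g := fun x : (φ.domᶜ : Set X) => (x : X))
        (measurable_subtype_coe.comp φ.toEquiv.measurable) measurable_subtype_coe
        φ.measurableSet_dom
    have hG : ∀ φ, Measurable (G φ) := fun φ =>
      Measurable.dite (g := fun x : (φ.rngᶜ : Set X) => (x : X))
        (measurable_subtype_coe.comp φ.toEquiv.symm.measurable) measurable_subtype_coe
        φ.measurableSet_rng
    have key : {x | Φ.graph.edist (f x) (g x) ≤ (n + 1 : ℕ)} =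
        {x | Φ.graph.edist (f x) (g x) ≤ n} ∪
        ((⋃ φ ∈ Φ.carrier, f ⁻¹' φ.dom ∩ {x | Φ.graph.edist (F φ (f x)) (g x) ≤ n}) ∪
         (⋃ φ ∈ Φ.carrier, f ⁻¹' φ.rng ∩ {x | Φ.graph.edist (G φ (f x)) (g x) ≤ n})) := by
      ext x
      simp only [mem_ofPred_eq, mem_union, mem_iUnion, mem_inter_iff, mem_preimage, exists_prop]
      rw [edist_le_succ_iff]
      refine or_congr Iff.rfl ?_
      constructor
      · rintro ⟨z, ⟨φ, hφ, hx, rfl⟩ | ⟨φ, hφ, hz, hzx⟩, h⟩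
        · left
          refine ⟨φ, hφ, hx, ?_⟩
          simpa [F, hx] using h
        · right
          have hx : f x ∈ φ.rng := hzx ▸ (φ.toEquiv ⟨z, hz⟩).2
          refine ⟨φ, hφ, hx, ?_⟩
          have : (⟨f x, hx⟩ : φ.rng) = φ.toEquiv ⟨z, hz⟩ := Subtype.ext hzx.symm
          have : G φ (f x) = z := by simp [G, hx, this]
          rwa [this]
      · rintro (⟨φ, hφ, hx, h⟩ | ⟨φ, hφ, hx, h⟩)
        · refine ⟨F φ (f x), Or.inl ⟨φ, hφ, hx, by simp [F, hx]⟩, h⟩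
        · refine ⟨G φ (f x), Or.inr ⟨φ, hφ, ?_, ?_⟩, h⟩
          · simp [G, hx]
          · simp [G, hx]
    rw [key]
    refine (ih f g hf hg).union (MeasurableSet.union ?_ ?_)
    · exact MeasurableSet.biUnion Φ.countable fun φ _ =>
        (hf φ.measurableSet_dom).inter (ih _ _ ((hF φ).comp hf) hg)
    · exact MeasurableSet.biUnion Φ.countable fun φ _ =>
        (hf φ.measurableSet_rng).inter (ih _ _ ((hG φ).comp hf) hg)

lemma measurable_d [StandardBorelSpace X] (Φ : Graphing μ) {f g : X → X} (hf : Measurable f)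
    (hg : Measurable g) : Measurable fun x => Φ.d (f x) (g x) := by
  have h1 : Measurable fun x => Φ.graph.edist (f x) (g x) := by
    refine measurable_to_countable' fun a => ?_
    have hle : ∀ n : ℕ, MeasurableSet {x | Φ.graph.edist (f x) (g x) ≤ n} := fun n =>
      Φ.measurableSet_edist_le n f g hf hg
    induction a using ENat.recTopCoe with
    | top =>
      have : (fun x => Φ.graph.edist (f x) (g x)) ⁻¹' {⊤} =
          (⋃ n : ℕ, {x | Φ.graph.edist (f x) (g x) ≤ n})ᶜ := by
        ext x
        simp only [mem_preimage, mem_singleton_iff, mem_compl_iff, mem_iUnion, mem_ofPred_eq,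
          not_exists, not_le]
        rw [ENat.eq_top_iff_forall_gt]
      rw [this]
      exact (MeasurableSet.iUnion hle).compl
    | coe n =>
      have : (fun x => Φ.graph.edist (f x) (g x)) ⁻¹' {(n : ℕ∞)} =
          {x | Φ.graph.edist (f x) (g x) ≤ n} \
            ⋃ m ∈ Set.Iio n, {x | Φ.graph.edist (f x) (g x) ≤ m} := by
        ext x
        simp only [mem_preimage, mem_singleton_iff, Set.mem_sdiff, mem_iUnion, mem_ofPred_eq,
          not_exists, mem_Iio, not_le, exists_prop, not_and]
        constructor
        · intro h
          rw [h]
          exact ⟨le_rfl, fun m hm => by exact_mod_cast hm⟩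
        · rintro ⟨h1, h2⟩
          obtain ⟨k, hk⟩ := ENat.ne_top_iff_exists.1 (ne_top_of_le_ne_top (ENat.natCast_ne_top n) h1)
          rw [← hk] at h1 h2 ⊢
          have h1' : k ≤ n := by exact_mod_cast h1
          rcases h1'.lt_or_eq with h3 | h3
          · exact absurd (h2 k h3) (lt_irrefl _)
          · rw [h3]
      rw [this]
      exact (hle n).diff (MeasurableSet.biUnion (to_countable _) fun m _ => hle m)
  exact (Measurable.of_discrete (f := fun a : ℕ∞ => (a : ℝ≥0∞))).comp h1

/-! ### The `L¹` full group -/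

lemma PreAut.measurable (T : PreAut μ) : Measurable T.1 := T.2.1.measurable

lemma lintegral_comp_aut (T : PreAut μ) {f : X → ℝ≥0∞} (hf : Measurable f) :
    ∫⁻ x, f (T.1 x) ∂μ = ∫⁻ x, f x ∂μ := T.2.1.lintegral_comp hf

variable [StandardBorelSpace X]

/-- The `L¹` full group `[Φ]₁`: the classes of all `T` such that `T x` and `x` are in the same
orbit for almost every `x`, and `x ↦ d_Φ(x, T x)` is integrable. -/
def fullGroup (Φ : Graphing μ) : Subgroup (Aut μ) :=
  Subgroup.map (QuotientGroup.mk' (nullAut μ))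
    { carrier := {T | (∀ᵐ x ∂μ, Φ.orbitRel x (T.1 x)) ∧ ∫⁻ x, Φ.d x (T.1 x) ∂μ < ∞}
      mul_mem' := fun {S T} hS hT => by
        have hTm : Measure.QuasiMeasurePreserving T.1 μ μ := T.2.1.quasiMeasurePreserving
        refine ⟨?_, ?_⟩
        · change ∀ᵐ x ∂μ, Φ.orbitRel x (S.1 (T.1 x))
          filter_upwards [hT.1, hTm.ae hS.1] with x h1 h2
          exact Φ.orbitRel.trans h1 h2
        · change ∫⁻ x, Φ.d x (S.1 (T.1 x)) ∂μ < ∞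
          have hm : Measurable fun x => Φ.d x (T.1 x) :=
            Φ.measurable_d measurable_id (PreAut.measurable T)
          have hm' : Measurable fun x => Φ.d x (S.1 x) :=
            Φ.measurable_d measurable_id (PreAut.measurable S)
          calc ∫⁻ x, Φ.d x (S.1 (T.1 x)) ∂μ
              ≤ ∫⁻ x, (Φ.d x (T.1 x) + Φ.d (T.1 x) (S.1 (T.1 x))) ∂μ :=
                lintegral_mono fun x => Φ.d_triangle _ _ _
            _ = ∫⁻ x, Φ.d x (T.1 x) ∂μ + ∫⁻ x, Φ.d (T.1 x) (S.1 (T.1 x)) ∂μ :=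
                lintegral_add_left hm _
            _ = ∫⁻ x, Φ.d x (T.1 x) ∂μ + ∫⁻ x, Φ.d x (S.1 x) ∂μ := by
                rw [lintegral_comp_aut T hm']
            _ < ∞ := ENNReal.add_lt_top.2 ⟨hT.2, hS.2⟩
      one_mem' := by
        refine ⟨Eventually.of_forall fun x => Φ.orbitRel.refl x, ?_⟩
        change ∫⁻ x, Φ.d x x ∂μ < ∞
        simp [d_self]
      inv_mem' := fun {T} hT => by
        have hTm : Measure.QuasiMeasurePreserving T.1.symm μ μ := (T⁻¹).2.1.quasiMeasurePreserving
        refine ⟨?_, ?_⟩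
        · change ∀ᵐ x ∂μ, Φ.orbitRel x (T.1.symm x)
          have hT1 : ∀ᵐ x ∂μ, Φ.orbitRel x (T.1 x) := hT.1
          filter_upwards [hTm.ae hT1] with x h1
          rw [Equiv.apply_symm_apply] at h1
          exact Φ.orbitRel.symm h1
        · have hm : Measurable fun x => Φ.d x ((T⁻¹).1 x) :=
            Φ.measurable_d measurable_id (PreAut.measurable T⁻¹)
          change ∫⁻ x, Φ.d x ((T⁻¹).1 x) ∂μ < ∞
          rw [← lintegral_comp_aut T hm]
          refine lt_of_eq_of_lt (lintegral_congr fun x => ?_) hT.2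
          change Φ.d (T.1 x) (T.1.symm (T.1 x)) = _
          rw [Equiv.symm_apply_apply, d_comm] }

/-- The distance `∫ d_Φ(S x, T x) dμ`, possibly infinite, between two elements of `Aut(X, μ)`. -/
noncomputable def l1dist (Φ : Graphing μ) (S T : Aut μ) : ℝ≥0∞ :=
  Quotient.liftOn₂' S T (fun S T => ∫⁻ x, Φ.d (S.1 x) (T.1 x) ∂μ) <| by
    intro S T S' T' hS hT
    have hS := (mk_eq_iff S S').1 (Quotient.sound' hS)
    have hT := (mk_eq_iff T T').1 (Quotient.sound' hT)
    refine lintegral_congr_ae ?_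
    filter_upwards [hS, hT] with x h1 h2
    rw [h1, h2]

lemma l1dist_mk (Φ : Graphing μ) (S T : PreAut μ) :
    Φ.l1dist (QuotientGroup.mk S) (QuotientGroup.mk T) = ∫⁻ x, Φ.d (S.1 x) (T.1 x) ∂μ := rfl

lemma l1dist_triangle (Φ : Graphing μ) (S T U : Aut μ) :
    Φ.l1dist S U ≤ Φ.l1dist S T + Φ.l1dist T U := by
  induction S using QuotientGroup.induction_on with | _ S
  induction T using QuotientGroup.induction_on with | _ T
  induction U using QuotientGroup.induction_on with | _ U
  simp only [l1dist_mk]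
  rw [← lintegral_add_left (Φ.measurable_d (PreAut.measurable S) (PreAut.measurable T))]
  exact lintegral_mono fun x => Φ.d_triangle _ _ _

lemma l1dist_comm (Φ : Graphing μ) (S T : Aut μ) : Φ.l1dist S T = Φ.l1dist T S := by
  induction S using QuotientGroup.induction_on with | _ S
  induction T using QuotientGroup.induction_on with | _ T
  simp only [l1dist_mk, d_comm]

lemma l1dist_self (Φ : Graphing μ) (S : Aut μ) : Φ.l1dist S S = 0 := by
  induction S using QuotientGroup.induction_on with | _ S
  simp [l1dist_mk, d_self]

lemma eq_of_l1dist (Φ : Graphing μ) {S T : Aut μ} (h : Φ.l1dist S T = 0) : S = T := by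
  induction S using QuotientGroup.induction_on with | _ S
  induction T using QuotientGroup.induction_on with | _ T
  rw [l1dist_mk,
    lintegral_eq_zero_iff (Φ.measurable_d (PreAut.measurable S) (PreAut.measurable T))] at h
  rw [mk_eq_iff]
  filter_upwards [h] with x hx
  exact d_eq_zero.1 hx

lemma l1dist_mul_right (Φ : Graphing μ) (S T U : Aut μ) :
    Φ.l1dist (S * U) (T * U) = Φ.l1dist S T := by
  induction S using QuotientGroup.induction_on with | _ S
  induction T using QuotientGroup.induction_on with | _ T
  induction U using QuotientGroup.induction_on with | _ U
  exact lintegral_comp_aut U (Φ.measurable_d (PreAut.measurable S) (PreAut.measurable T))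

/-- Elements of `[Φ]₁` are at finite distance from each other, so this is a genuine metric; only
the topology matters below. -/
lemma l1dist_lt_top (Φ : Graphing μ) (S T : Φ.fullGroup) : Φ.l1dist S.1 T.1 < ∞ := by
  have key : ∀ U : Φ.fullGroup, Φ.l1dist 1 U.1 < ∞ := by
    rintro ⟨_, U, hU, rfl⟩
    exact hU.2
  refine (Φ.l1dist_triangle S.1 1 T.1).trans_lt (ENNReal.add_lt_top.2 ⟨?_, key T⟩)
  rw [l1dist_comm]
  exact key S

/-- `[Φ]₁` with the metric `∫ d_Φ(S x, T x) dμ`. -/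
noncomputable instance fullGroupEMetric (Φ : Graphing μ) : EMetricSpace Φ.fullGroup where
  edist S T := Φ.l1dist S.1 T.1
  edist_self S := Φ.l1dist_self S.1
  edist_comm S T := Φ.l1dist_comm S.1 T.1
  edist_triangle S T U := Φ.l1dist_triangle S.1 T.1 U.1
  eq_of_edist_eq_zero h := Subtype.ext (Φ.eq_of_l1dist h)

lemma edist_def (Φ : Graphing μ) (S T : Φ.fullGroup) : edist S T = Φ.l1dist S.1 T.1 := rfl

lemma edist_mul_right (Φ : Graphing μ) (S T U : Φ.fullGroup) :
    edist (S * U) (T * U) = edist S T := Φ.l1dist_mul_right S.1 T.1 U.1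

lemma tendsto_mul_left_one (Φ : Graphing μ) (V : Φ.fullGroup) :
    Tendsto (fun W : Φ.fullGroup => edist (V * W) V) (𝓝 1) (𝓝 0) := by
  obtain ⟨_, V, hV, rfl⟩ := V
  let s : Φ.fullGroup → Set X := fun W => {x | (Quotient.out W.1).1 x ≠ x}
  have hout : ∀ W : Φ.fullGroup, (QuotientGroup.mk (Quotient.out W.1) : Aut μ) = W.1 :=
    fun W => Quotient.out_eq' _
  have hedist : ∀ W : Φ.fullGroup, edist W 1 = ∫⁻ x, Φ.d ((Quotient.out W.1).1 x) x ∂μ := by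
    intro W
    rw [edist_def, ← hout W]
    conv_rhs => rw [hout W]
    rfl
  have hmeas : ∀ W, MeasurableSet (s W) := by
    intro W
    let _ := upgradeStandardBorel X
    exact (measurableSet_eq_fun (PreAut.measurable _) measurable_id).compl
  have hs1 : ∀ W, μ (s W) ≤ edist W 1 := by
    intro W
    rw [hedist]
    calc μ (s W) = ∫⁻ x, (s W).indicator 1 x ∂μ := (lintegral_indicator_one (hmeas W)).symm
      _ ≤ _ := lintegral_mono fun x => by
        by_cases hx : x ∈ s W
        · rw [indicator_of_mem hx]
          exact one_le_d hx
        · rw [indicator_of_notMem hx]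
          exact zero_le
  have he : Tendsto (fun W : Φ.fullGroup => edist W 1) (𝓝 1) (𝓝 0) := by
    have := (continuous_id.edist (continuous_const (y := (1 : Φ.fullGroup)))).tendsto 1
    simpa using this
  have hs : Tendsto (μ ∘ s) (𝓝 1) (𝓝 0) :=
    tendsto_of_tendsto_of_tendsto_of_le_of_le tendsto_const_nhds he (fun _ => zero_le) hs1
  have hmV : Measurable fun x => Φ.d x (V.1 x) :=
    Φ.measurable_d measurable_id (PreAut.measurable V)
  have hI := tendsto_setLIntegral_zero (f := fun x => Φ.d x (V.1 x)) hV.2.ne hs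
  -- the bound
  have hb : ∀ W : Φ.fullGroup,
      edist ((⟨_, V, hV, rfl⟩ : Φ.fullGroup) * W) ⟨_, V, hV, rfl⟩ ≤
        ∫⁻ x in s W, Φ.d x (V.1 x) ∂μ + edist W 1 + ∫⁻ x in s W, Φ.d x (V.1 x) ∂μ := by
    intro W
    set w := Quotient.out W.1 with hw
    have h0 : edist ((⟨_, V, hV, rfl⟩ : Φ.fullGroup) * W) ⟨_, V, hV, rfl⟩ =
        ∫⁻ x, Φ.d (V.1 (w.1 x)) (V.1 x) ∂μ := by
      change Φ.l1dist (QuotientGroup.mk V * W.1) (QuotientGroup.mk V) = _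
      rw [← hout W]
      rfl
    rw [h0, hedist]
    have hmw := PreAut.measurable w
    have hmem : ∀ x, w.1 x ∈ s W ↔ x ∈ s W := by
      intro x
      change w.1 (w.1 x) ≠ w.1 x ↔ w.1 x ≠ x
      exact w.1.injective.ne_iff
    have h1 : ∫⁻ x in s W, Φ.d x (V.1 x) ∂μ =
        ∫⁻ x, (s W).indicator (fun x => Φ.d x (V.1 x)) (w.1 x) ∂μ := by
      rw [lintegral_comp_aut w (hmV.indicator (hmeas W)), lintegral_indicator (hmeas W)]
    have h2 : ∫⁻ x in s W, Φ.d x (V.1 x) ∂μ =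
        ∫⁻ x, (s W).indicator (fun x => Φ.d x (V.1 x)) x ∂μ := by
      rw [lintegral_indicator (hmeas W)]
    calc ∫⁻ x, Φ.d (V.1 (w.1 x)) (V.1 x) ∂μ
        ≤ ∫⁻ x, ((s W).indicator (fun x => Φ.d x (V.1 x)) (w.1 x) + Φ.d (w.1 x) x +
            (s W).indicator (fun x => Φ.d x (V.1 x)) x) ∂μ := by
          refine lintegral_mono fun x => ?_
          by_cases hx : x ∈ s W
          · rw [indicator_of_mem hx, indicator_of_mem ((hmem x).2 hx)]
            refine (Φ.d_triangle _ x _).trans (add_le_add ?_ le_rfl)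
            refine (Φ.d_triangle _ (w.1 x) _).trans (add_le_add ?_ le_rfl)
            rw [d_comm]
          · have hx' : w.1 x = x := not_not.1 hx
            simp [hx', d_self]
      _ = _ := by
          rw [lintegral_add_left, lintegral_add_left, ← h1, ← h2]
          · exact (hmV.indicator (hmeas W)).comp hmw
          · exact ((hmV.indicator (hmeas W)).comp hmw).add (Φ.measurable_d hmw measurable_id)
  refine tendsto_of_tendsto_of_tendsto_of_le_of_le tendsto_const_nhds ?_ (fun _ => zero_le) hb
  simpa using (hI.add he).add hI

lemma tendsto_mul_left (Φ : Graphing μ) (V U : Φ.fullGroup) :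
    Tendsto (fun W : Φ.fullGroup => V * W) (𝓝 U) (𝓝 (V * U)) := by
  rw [tendsto_iff_edist_tendsto_0]
  have h : Tendsto (fun W : Φ.fullGroup => W * U⁻¹) (𝓝 U) (𝓝 1) := by
    rw [tendsto_iff_edist_tendsto_0]
    have : ∀ W : Φ.fullGroup, edist (W * U⁻¹) 1 = edist W U := by
      intro W
      rw [← Φ.edist_mul_right _ _ U]
      simp
    simp only [this]
    simpa using (continuous_id.edist (continuous_const (y := U))).tendsto U
  refine ((Φ.tendsto_mul_left_one V).comp h).congr fun W => ?_
  simp only [Function.comp]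
  rw [← Φ.edist_mul_right _ _ U]
  simp [mul_assoc]

instance fullGroup_isTopologicalGroup (Φ : Graphing μ) : IsTopologicalGroup Φ.fullGroup where
  continuous_mul := by
    rw [continuous_iff_continuousAt]
    rintro ⟨V, U⟩
    change Tendsto (fun p : Φ.fullGroup × Φ.fullGroup => p.1 * p.2) (𝓝 (V, U)) (𝓝 (V * U))
    rw [tendsto_iff_edist_tendsto_0]
    have h1 : Tendsto (fun p : Φ.fullGroup × Φ.fullGroup => edist p.1 V) (𝓝 (V, U)) (𝓝 0) := by
      simpa using (continuous_fst.edist (continuous_const (y := V))).tendsto (V, U)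
    have h2 : Tendsto (fun p : Φ.fullGroup × Φ.fullGroup => edist (V * p.2) (V * U))
        (𝓝 (V, U)) (𝓝 0) :=
      (tendsto_iff_edist_tendsto_0.1 (Φ.tendsto_mul_left V U)).comp
        (continuous_snd.tendsto (V, U))
    refine tendsto_of_tendsto_of_tendsto_of_le_of_le tendsto_const_nhds
      (by simpa using h1.add h2) (fun _ => zero_le) fun p => ?_
    refine (edist_triangle _ (V * p.2) _).trans (add_le_add ?_ le_rfl)
    rw [Φ.edist_mul_right]
  continuous_inv := by
    rw [continuous_iff_continuousAt]
    intro V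
    change Tendsto (fun W : Φ.fullGroup => W⁻¹) (𝓝 V) (𝓝 V⁻¹)
    rw [tendsto_iff_edist_tendsto_0]
    refine (tendsto_iff_edist_tendsto_0.1 (Φ.tendsto_mul_left V⁻¹ V)).congr fun W => ?_
    rw [← Φ.edist_mul_right W⁻¹ _ W, edist_comm]
    simp

/-- The closure of the derived group (commutator subgroup) of `[Φ]₁`. -/
noncomputable abbrev derivedClosure (Φ : Graphing μ) : Subgroup Φ.fullGroup :=
  (commutator Φ.fullGroup).topologicalClosure

/-- The subgroup of all elements of the closure of the derived group of `[Φ]₁` supported in `A`. -/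
noncomputable def derivedClosureOn (Φ : Graphing μ) (A : Set X) : Subgroup Φ.derivedClosure :=
  (supportedIn μ A).comap (Φ.fullGroup.subtype.comp Φ.derivedClosure.subtype)

end Graphing

/-- A topological group is topologically simple when it is nontrivial and its only closed normal
subgroups are the trivial one and itself. -/
def TopologicallySimple (G : Type*) [Group G] [TopologicalSpace G] : Prop :=
  Nontrivial G ∧ ∀ N : Subgroup G, N.Normal → IsClosed (N : Set G) → N = ⊥ ∨ N = ⊤

/-- Almost all orbits of the transformation `T` are infinite. -/
def AperiodicMap (μ : Measure X) (T : X ≃ᵐ X) : Prop :=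
  ∀ᵐ x ∂μ, (Set.range fun n : ℤ => ((T.toEquiv : Equiv.Perm X) ^ n) x).Infinite

end L1Full

/-!
The proof rests on the involutions of `[Φ]₁`, and on the fact that the orbits of an aperiodic
graphing meet every non-null set infinitely often or not at all (`ae_infinite_inter`).

*Involutions generate.* The closed group generated by the involutions contains every commutator
(`L1Closed.commutator_mem`). If `C` is disjoint from `T C`, composing `T` with the involution
exchanging `C` and `T C` yields the transformation induced by `T` on the complement of `C`. Repeating
this, `T` and `U` can be modified by products of involutions until the displacements of both are
small on the intersection of their supports; then they almost commute. Conversely, every involution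
`U` is locally a commutator of two involutions (`exists_restr_eq_commutator`): by recurrence, a
non-null `E` disjoint from `U E` contains disjoint non-null sets exchanged by an element of the full
group, which doubles the transposition `E ↔ U E` into an even permutation of four pieces. An
exhaustion argument (`L1Closed.mem_of_local`) passes from local to global, so `D([Φ]₁)` and the
involutions generate the same closed subgroup.

*Normal subgroups.* Let `N` be a closed normal subgroup of this group, and let `S ∈ N` move `B` off
itself. Since `⁅⁅U, S⁆, V⁆ = ⁅U, V⁆` for `U` and `V` supported in `B`, and involutions are local
commutators, `N` contains the involutions supported in `B`; it contains those supported in the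
saturation of `B` because, by recurrence, these are locally conjugate to involutions supported
in `B` (`L1Closed.involution_mem_of_saturation`). Hence, if `A` is a largest invariant set all of
whose involutions lie in `N`, then `N` is supported in `A`; and it contains everything supported in
`A`, by restricting products of involutions to `A` (`exists_eq_derivedClosureOn`). The set `A` is
determined by `N` since every non-null set supports a nontrivial involution. The correspondence
between closed normal subgroups and invariant sets turns simplicity into ergodicity
(`isErgodic_iff_topologicallySimple`).

Classes modulo null sets are represented by transformations which preserve every orbit
(`toFull_surjective`), so that invariant sets are literally stable.
-/

namespace L1Full

variable {X : Type*} [MeasurableSpace X] {μ : Measure X}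

/-! ### Exhaustion and separation -/

/-- Exhaustion principle: a class of measurable sets which is closed under countable disjoint unions
has a member outside of which there is no non-null member. -/
theorem exists_exhausting [IsFiniteMeasure μ] (p : Set X → Prop) (h0 : p ∅)
    (hm : ∀ C, p C → MeasurableSet C)
    (hU : ∀ C : ℕ → Set X, (∀ n, p (C n)) → Pairwise (Function.onFun Disjoint C) →
      p (⋃ n, C n)) :
    ∃ C, p C ∧ ∀ D, p D → Disjoint D C → μ D = 0 := by
  classical
  -- every step captures at least half of what is still available
  have step : ∀ A : Set X, ∃ D, p D ∧ Disjoint D A ∧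
      ∀ D', p D' → Disjoint D' A → μ D' ≤ 2 * μ D := by
    intro A
    let s : ℝ≥0∞ := ⨆ D : {D : Set X // p D ∧ Disjoint D A}, μ D.1
    have hs : ∀ D', p D' → Disjoint D' A → μ D' ≤ s := fun D' h1 h2 =>
      le_iSup (fun D : {D : Set X // p D ∧ Disjoint D A} => μ D.1) ⟨D', h1, h2⟩
    by_cases hs0 : s = 0
    · refine ⟨∅, h0, empty_disjoint _, fun D' h1 h2 => ?_⟩
      simpa [hs0] using hs D' h1 h2
    · have hst : s ≠ ∞ := ne_top_of_le_ne_top (measure_ne_top μ univ)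
        (iSup_le fun D => measure_mono (subset_univ _))
      obtain ⟨⟨D, h1, h2⟩, hD⟩ := lt_iSup_iff.1 (ENNReal.half_lt_self hs0 hst)
      refine ⟨D, h1, h2, fun D' h1 h2 => (hs D' h1 h2).trans ?_⟩
      have : s / 2 * 2 ≤ μ D * 2 := by gcongr
      rwa [ENNReal.div_mul_cancel (by simp) (by simp), mul_comm] at this
  choose D hD1 hD2 hD3 using step
  let A : ℕ → Set X := fun n => Nat.rec ∅ (fun _ A => A ∪ D A) n
  have hAs : ∀ n, A (n + 1) = A n ∪ D (A n) := fun n => rfl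
  have hA : ∀ n, ∀ m < n, D (A m) ⊆ A n := by
    intro n
    induction n with
    | zero => intro m hm; omega
    | succ n ih =>
      intro m hm
      rw [hAs]
      rcases Nat.lt_succ_iff_lt_or_eq.1 hm with h | rfl
      · exact (ih m h).trans subset_union_left
      · exact subset_union_right
  have hdisj : Pairwise (Function.onFun Disjoint fun n => D (A n)) := by
    intro m n hmn
    rcases hmn.lt_or_gt with h | h
    · exact ((hD2 (A n)).mono_right (hA n m h)).symm
    · exact (hD2 (A m)).mono_right (hA m n h)
  refine ⟨⋃ n, D (A n), hU _ (fun n => hD1 _) hdisj, fun D' h1 h2 => ?_⟩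
  have hAU : ∀ n, A n ⊆ ⋃ n, D (A n) := by
    intro n
    induction n with
    | zero => exact empty_subset _
    | succ n ih => exact union_subset ih (subset_iUnion (fun n => D (A n)) n)
  have hsum : ∑' n, μ (D (A n)) ≠ ∞ := by
    rw [← measure_iUnion hdisj fun n => hm _ (hD1 _)]
    exact measure_ne_top _ _
  have hlim : Tendsto (fun n => 2 * μ (D (A n))) atTop (𝓝 0) := by
    simpa using ENNReal.Tendsto.const_mul (ENNReal.tendsto_atTop_zero_of_tsum_ne_top hsum)
      (Or.inr (by simp : (2 : ℝ≥0∞) ≠ ∞))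
  exact le_antisymm (ge_of_tendsto' hlim fun n => hD3 _ D' h1 (h2.mono_right (hAU n))) zero_le

theorem exists_countable_separating (X : Type*) [MeasurableSpace X] [StandardBorelSpace X] :
    ∃ A : ℕ × Bool → Set X, (∀ i, MeasurableSet (A i)) ∧
      ∀ x y, x ≠ y → ∃ i, x ∈ A i ∧ y ∉ A i := by
  obtain ⟨f, hf, hinj⟩ := MeasurableSpace.measurable_injection_nat_bool_of_countablySeparated X
  refine ⟨fun i => {x | f x i.1 = i.2}, fun i => ?_, fun x y hxy => ?_⟩
  · exact (measurable_pi_iff.1 hf i.1) (measurableSet_singleton i.2)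
  · obtain ⟨n, hn⟩ := Function.ne_iff.1 fun h => hxy (hinj h)
    exact ⟨(n, f x n), rfl, fun h => hn h.symm⟩

/-- Two measurable maps which differ at all points of a non-null set send some non-null subset of it
to disjoint sets. -/
theorem exists_subset_disjoint_images [StandardBorelSpace X] {E : Set X} (hE : MeasurableSet E)
    (h0 : μ E ≠ 0) {f g : X → X} (hf : Measurable f) (hg : Measurable g)
    (hfg : ∀ x ∈ E, f x ≠ g x) :
    ∃ E' ⊆ E, MeasurableSet E' ∧ μ E' ≠ 0 ∧ ∀ x ∈ E', ∀ y ∈ E', f x ≠ g y := by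
  obtain ⟨A, hA, hsep⟩ := exists_countable_separating X
  by_contra! hcon
  refine h0 (measure_mono_null (t := ⋃ i, E ∩ (f ⁻¹' A i \ g ⁻¹' A i)) ?_ ?_)
  · intro x hx
    obtain ⟨i, h1, h2⟩ := hsep _ _ (hfg x hx)
    exact mem_iUnion.2 ⟨i, hx, h1, h2⟩
  · refine measure_iUnion_null fun i => ?_
    by_contra hi
    obtain ⟨x, hx, y, hy, hxy⟩ := hcon _ inter_subset_left
      (hE.inter ((hf (hA i)).diff (hg (hA i)))) hi
    exact hy.2.2 (show g y ∈ A i from hxy ▸ hx.2.1)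

/-- Simultaneous version of `exists_subset_disjoint_images` for finitely many pairs of maps. -/
theorem exists_subset_disjoint_images_list [StandardBorelSpace X] {E : Set X}
    (hE : MeasurableSet E) (h0 : μ E ≠ 0) (l : List ((X → X) × (X → X)))
    (hl : ∀ q ∈ l, Measurable q.1 ∧ Measurable q.2)
    (hne : ∀ q ∈ l, ∀ x ∈ E, q.1 x ≠ q.2 x) :
    ∃ E' ⊆ E, MeasurableSet E' ∧ μ E' ≠ 0 ∧ ∀ q ∈ l, ∀ x ∈ E', ∀ y ∈ E', q.1 x ≠ q.2 y := by
  induction l with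
  | nil => exact ⟨E, Subset.rfl, hE, h0, by simp⟩
  | cons q l ih =>
    obtain ⟨E1, h1, hE1, h01, hd1⟩ := ih (fun q hq => hl q (List.mem_cons_of_mem _ hq))
      (fun q hq => hne q (List.mem_cons_of_mem _ hq))
    have hq := hl q List.mem_cons_self
    obtain ⟨E2, h2, hE2, h02, hd2⟩ := exists_subset_disjoint_images hE1 h01 hq.1 hq.2
      fun x hx => hne q List.mem_cons_self x (h1 hx)
    refine ⟨E2, h2.trans h1, hE2, h02, fun r hr x hx y hy => ?_⟩
    rcases List.mem_cons.1 hr with rfl | hr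
    · exact hd2 x hx y hy
    · exact hd1 r hr x (h2 hx) y (h2 hy)

/-! ### Gluing measure-preserving transformations -/

open Classical in
/-- A measure-preserving bijection `f : E → F` between disjoint sets extends to an involution which
exchanges `E` with `F` and fixes all other points. -/
theorem exists_exchange {E F : Set X} (hE : MeasurableSet E) (hF : MeasurableSet F)
    (hEF : Disjoint E F) {f g : X → X} (hf : Measurable f) (hg : Measurable g)
    (h1 : ∀ x ∈ E, f x ∈ F ∧ g (f x) = x) (h2 : ∀ y ∈ F, g y ∈ E ∧ f (g y) = y)
    (hμ : ∀ S, MeasurableSet S → μ (E ∩ f ⁻¹' S) = μ (F ∩ S)) :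
    ∃ U : PreAut μ, (∀ x ∈ E, U.1 x = f x) ∧ (∀ y ∈ F, U.1 y = g y) ∧
      ∀ x, x ∉ E → x ∉ F → U.1 x = x := by
  let u : X → X := fun x => if x ∈ E then f x else if x ∈ F then g x else x
  have uE : ∀ x ∈ E, u x = f x := fun x hx => by simp [u, hx]
  have uF : ∀ y ∈ F, u y = g y := fun y hy => by
    simp [u, hy, hEF.notMem_of_mem_right hy]
  have uN : ∀ x, x ∉ E → x ∉ F → u x = x := fun x h1 h2 => by simp [u, h1, h2]
  have hinv : Function.Involutive u := by
    intro x
    by_cases hx : x ∈ E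
    · rw [uE x hx, uF _ (h1 x hx).1, (h1 x hx).2]
    · by_cases hx' : x ∈ F
      · rw [uF x hx', uE _ (h2 x hx').1, (h2 x hx').2]
      · rw [uN x hx hx', uN x hx hx']
  have hum : Measurable u := Measurable.ite hE hf (Measurable.ite hF hg measurable_id)
  have hμ' : ∀ S, MeasurableSet S → μ (F ∩ g ⁻¹' S) = μ (E ∩ S) := by
    intro S hS
    rw [← hμ _ (hg hS)]
    congr 1
    ext x
    refine and_congr_right fun hx => ?_
    simp [(h1 x hx).2]
  have hmp : MeasurePreserving u μ μ := by
    refine ⟨hum, ?_⟩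
    ext S hS
    rw [Measure.map_apply hum hS]
    have key : ∀ B : Set X, MeasurableSet B →
        μ B = μ (E ∩ B) + (μ (F ∩ B) + μ ((E ∪ F)ᶜ ∩ B)) := by
      intro B hB
      rw [← measure_inter_add_sdiff₀ B hE.nullMeasurableSet, inter_comm]
      congr 1
      rw [← measure_inter_add_sdiff₀ (B \ E) hF.nullMeasurableSet]
      congr 2
      · ext x
        exact ⟨fun h => ⟨h.2, h.1.1⟩,
          fun h => ⟨⟨h.2, hEF.notMem_of_mem_right h.1⟩, h.1⟩⟩
      · ext x
        simp only [Set.mem_sdiff, mem_inter_iff, mem_compl_iff, mem_union]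
        tauto
    rw [key _ (hum hS), key S hS]
    have e1 : E ∩ u ⁻¹' S = E ∩ f ⁻¹' S := by
      ext x; exact and_congr_right fun hx => by simp [uE x hx]
    have e2 : F ∩ u ⁻¹' S = F ∩ g ⁻¹' S := by
      ext x; exact and_congr_right fun hx => by simp [uF x hx]
    have e3 : (E ∪ F)ᶜ ∩ u ⁻¹' S = (E ∪ F)ᶜ ∩ S := by
      ext x
      refine and_congr_right fun hx => ?_
      simp only [mem_compl_iff, mem_union, not_or] at hx
      simp [uN x hx.1 hx.2]
    rw [e1, e2, e3, hμ S hS, hμ' S hS, add_left_comm]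
  exact ⟨⟨hinv.toPerm, hmp, hum⟩, uE, uF, uN⟩

open Classical in
theorem exists_restrict (T : PreAut μ) {C : Set X} (hC : MeasurableSet C)
    (hT : ∀ x, T.1 x ∈ C ↔ x ∈ C) :
    ∃ U : PreAut μ, (∀ x ∈ C, U.1 x = T.1 x) ∧ ∀ x, x ∉ C → U.1 x = x := by
  have hT' : ∀ x, T.1.symm x ∈ C ↔ x ∈ C := fun x => by
    rw [← hT, Equiv.apply_symm_apply]
  let u : X → X := fun x => if x ∈ C then T.1 x else x
  let v : X → X := fun x => if x ∈ C then T.1.symm x else x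
  have hum : Measurable u := Measurable.ite hC T.2.1.measurable measurable_id
  have hvm : Measurable v := Measurable.ite hC T.2.2 measurable_id
  have huv : ∀ x, v (u x) = x := fun x => by
    by_cases hx : x ∈ C
    · simp [u, v, hx, hT]
    · simp [u, v, hx]
  have hvu : ∀ x, u (v x) = x := fun x => by
    by_cases hx : x ∈ C
    · simp [u, v, hx, hT']
    · simp [u, v, hx]
  have hmp : MeasurePreserving u μ μ := by
    refine ⟨hum, ?_⟩
    ext S hS
    rw [Measure.map_apply hum hS, ← measure_inter_add_sdiff (u ⁻¹' S) hC,
      ← measure_inter_add_sdiff S hC]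
    congr 1
    · rw [← T.2.1.measure_preimage (hS.inter hC).nullMeasurableSet]
      congr 1
      ext x
      simp only [mem_inter_iff, mem_preimage, hT]
      exact and_congr_left fun hx => by simp [u, hx]
    · congr 1
      ext x
      exact and_congr_left fun hx => by simp [u, hx]
  exact ⟨⟨⟨u, v, huv, hvu⟩, hmp, hvm⟩, fun x hx => by simp [u, hx], fun x hx => by simp [u, hx]⟩

end L1Full

namespace L1Full.Graphing

variable {X : Type*} [MeasurableSpace X] {μ : Measure X} {Φ : Graphing μ}

/-! ### Invariant sets and generators -/

lemma subset_saturation (A : Set X) : A ⊆ Φ.saturation A := fun x hx => ⟨x, hx, Φ.orbitRel.refl x⟩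

lemma invariant_saturation (A : Set X) : Φ.Invariant (Φ.saturation A) :=
  fun _ _ hxy ⟨z, hz, hzx⟩ => ⟨z, hz, Φ.orbitRel.trans hzx hxy⟩

lemma d_le_one_of_rel {x y : X} (h : Φ.rel x y ∨ Φ.rel y x) : Φ.d x y ≤ 1 := by
  have : Φ.graph.edist x y ≤ ((0 + 1 : ℕ) : ℕ∞) :=
    (Φ.edist_le_succ_iff x y 0).2 (Or.inr ⟨y, h, by simp⟩)
  simpa [d] using ENat.toENNReal_le.2 this

variable [StandardBorelSpace X]

/-! ### Representatives which preserve every orbit -/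

/-- The transformations `T` which map *every* point `x` into its own orbit and for which
`d_Φ(x, T x)` is integrable. Working with these representatives of the elements of the `L¹` full
group avoids null sets: an invariant set is literally stable under them. -/
def exact (Φ : Graphing μ) : Subgroup (PreAut μ) where
  carrier := {T | (∀ x, Φ.orbitRel x (T.1 x)) ∧ (QuotientGroup.mk T : Aut μ) ∈ Φ.fullGroup}
  mul_mem' := fun {S T} hS hT =>
    ⟨fun x => Φ.orbitRel.trans (hT.1 x) (hS.1 (T.1 x)), mul_mem hS.2 hT.2⟩
  one_mem' := ⟨fun x => Φ.orbitRel.refl x, one_mem _⟩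
  inv_mem' := fun {T} hT => ⟨fun x => by
    have h := hT.1 (T.1.symm x)
    rw [Equiv.apply_symm_apply] at h
    exact Φ.orbitRel.symm h, inv_mem hT.2⟩

lemma mem_exact_of {T : PreAut μ} (h1 : ∀ x, Φ.orbitRel x (T.1 x))
    (h2 : ∫⁻ x, Φ.d x (T.1 x) ∂μ < ∞) : T ∈ Φ.exact :=
  ⟨h1, T, ⟨Eventually.of_forall h1, h2⟩, rfl⟩

lemma orbitRel_smul (T : Φ.exact) (x : X) : Φ.orbitRel x (T • x) := T.2.1 x

lemma measurePreserving_smul (T : Φ.exact) : MeasurePreserving (fun x => T • x) μ μ := T.1.2.1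

lemma measurable_smul (T : Φ.exact) : Measurable fun x : X => T • x :=
  (measurePreserving_smul T).measurable

lemma lintegral_smul (T : Φ.exact) {f : X → ℝ≥0∞} (hf : Measurable f) :
    ∫⁻ x, f (T • x) ∂μ = ∫⁻ x, f x ∂μ := (measurePreserving_smul T).lintegral_comp hf

lemma measurable_d_smul (S T : Φ.exact) : Measurable fun x => Φ.d (S • x) (T • x) :=
  Φ.measurable_d (measurable_smul S) (measurable_smul T)

lemma measurable_d_self_smul (T : Φ.exact) : Measurable fun x => Φ.d x (T • x) :=
  Φ.measurable_d measurable_id (measurable_smul T)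

lemma lintegral_d_smul_lt_top (T : Φ.exact) : ∫⁻ x : X, Φ.d x (T • x) ∂μ < ∞ := by
  have := Φ.l1dist_lt_top 1 ⟨_, T.2.2⟩
  exact this

@[ext]
lemma exact_ext {S T : Φ.exact} (h : ∀ x : X, S • x = T • x) : S = T :=
  Subtype.ext (Subtype.ext (Equiv.ext h))

lemma measurableSet_preimage_smul (T : Φ.exact) {C : Set X} (hC : MeasurableSet C) :
    MeasurableSet {x | T • x ∈ C} := measurable_smul T hC

lemma measure_preimage_smul (T : Φ.exact) {C : Set X} (hC : MeasurableSet C) :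
    μ {x | T • x ∈ C} = μ C := (measurePreserving_smul T).measure_preimage hC.nullMeasurableSet

lemma measurableSet_support (T : Φ.exact) : MeasurableSet {x : X | T • x ≠ x} := by
  let _ := upgradeStandardBorel X
  exact (measurableSet_eq_fun (measurable_smul T) measurable_id).compl

lemma Invariant.smul_mem_iff {A : Set X} (hA : Φ.Invariant A) (T : Φ.exact) (x : X) :
    T • x ∈ A ↔ x ∈ A :=
  ⟨hA _ _ (Φ.orbitRel.symm (orbitRel_smul T x)), hA _ _ (orbitRel_smul T x)⟩

lemma exists_restr (T : Φ.exact) {C : Set X} (hC : MeasurableSet C)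
    (hT : ∀ x, T • x ∈ C ↔ x ∈ C) :
    ∃ R : Φ.exact, (∀ x ∈ C, R • x = T • x) ∧ ∀ x, x ∉ C → R • x = x := by
  obtain ⟨U, h1, h2⟩ := exists_restrict T.1 hC hT
  refine ⟨⟨U, mem_exact_of (fun x => ?_) (lt_of_le_of_lt (lintegral_mono fun x => ?_)
    (lintegral_d_smul_lt_top T))⟩, h1, h2⟩
  · by_cases hx : x ∈ C
    · rw [h1 x hx]; exact orbitRel_smul T x
    · rw [h2 x hx]
  · by_cases hx : x ∈ C
    · rw [h1 x hx]; exact le_rfl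
    · rw [h2 x hx, d_self]; exact zero_le

open Classical in
/-- The transformation which coincides with `T` on `C` and with the identity elsewhere. It is the
identity, by convention, unless `C` is a `T`-invariant measurable set. -/
noncomputable def restr (T : Φ.exact) (C : Set X) : Φ.exact :=
  if h : MeasurableSet C ∧ ∀ x, T • x ∈ C ↔ x ∈ C then (exists_restr T h.1 h.2).choose else 1

lemma restr_smul_of_mem {T : Φ.exact} {C : Set X} (hC : MeasurableSet C)
    (hT : ∀ x, T • x ∈ C ↔ x ∈ C) {x : X} (hx : x ∈ C) : restr T C • x = T • x := by
  rw [restr, dif_pos ⟨hC, hT⟩]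
  exact (exists_restr T hC hT).choose_spec.1 x hx

lemma restr_smul_of_notMem {T : Φ.exact} {C : Set X} (hC : MeasurableSet C)
    (hT : ∀ x, T • x ∈ C ↔ x ∈ C) {x : X} (hx : x ∉ C) : restr T C • x = x := by
  rw [restr, dif_pos ⟨hC, hT⟩]
  exact (exists_restr T hC hT).choose_spec.2 x hx

lemma restr_involutive {U : Φ.exact} (hU : ∀ x : X, U • U • x = x) {C : Set X}
    (hC : MeasurableSet C) (hCU : ∀ x, U • x ∈ C ↔ x ∈ C) (x : X) :
    restr U C • restr U C • x = x := by
  by_cases hx : x ∈ C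
  · rw [restr_smul_of_mem hC hCU hx, restr_smul_of_mem hC hCU ((hCU x).2 hx), hU]
  · rw [restr_smul_of_notMem hC hCU hx, restr_smul_of_notMem hC hCU hx]

lemma exists_swap (T : Φ.exact) {C : Set X} (hC : MeasurableSet C) (hd : ∀ x ∈ C, T • x ∉ C) :
    ∃ U : Φ.exact, (∀ x ∈ C, U • x = T • x) ∧ (∀ x, T⁻¹ • x ∈ C → U • x = T⁻¹ • x) ∧
      ∀ x, x ∉ C → T⁻¹ • x ∉ C → U • x = x := by
  obtain ⟨U, h1, h2, h3⟩ := exists_exchange (μ := μ) (F := {x | T⁻¹ • x ∈ C}) hC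
    (measurableSet_preimage_smul T⁻¹ hC)
    (disjoint_left.2 fun x hx hx' => hd _ hx' (by rwa [smul_inv_smul]))
    (measurable_smul T) (measurable_smul T⁻¹)
    (fun x hx => ⟨by simpa using hx, inv_smul_smul T x⟩)
    (fun x hx => ⟨hx, smul_inv_smul T x⟩) (fun S hS => by
      rw [← measure_preimage_smul T ((measurableSet_preimage_smul T⁻¹ hC).inter hS)]
      congr 1
      ext x
      simp)
  refine ⟨⟨U, mem_exact_of (fun x => ?_) (lt_of_le_of_lt (lintegral_mono
    (g := fun x => Φ.d x (T • x) + Φ.d x (T⁻¹ • x)) fun x => ?_) ?_)⟩, h1, h2, h3⟩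
  · by_cases hx : x ∈ C
    · rw [h1 x hx]; exact orbitRel_smul T x
    · by_cases hx' : T⁻¹ • x ∈ C
      · rw [h2 x hx']; exact orbitRel_smul T⁻¹ x
      · rw [h3 x hx hx']
  · by_cases hx : x ∈ C
    · rw [h1 x hx]; exact le_self_add
    · by_cases hx' : T⁻¹ • x ∈ C
      · rw [h2 x hx']; exact le_add_self
      · rw [h3 x hx hx', d_self]; exact zero_le
  · rw [lintegral_add_left (measurable_d_self_smul T)]
    exact ENNReal.add_lt_top.2 ⟨lintegral_d_smul_lt_top T, lintegral_d_smul_lt_top T⁻¹⟩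

open Classical in
/-- The involution which exchanges `C` with `T C` through `T` and fixes all other points. It is the
identity, by convention, unless `C` is a measurable set disjoint from `T C`. -/
noncomputable def swap (T : Φ.exact) (C : Set X) : Φ.exact :=
  if h : MeasurableSet C ∧ ∀ x ∈ C, T • x ∉ C then (exists_swap T h.1 h.2).choose else 1

section swap

variable {T : Φ.exact} {C : Set X} (hC : MeasurableSet C) (hd : ∀ x ∈ C, T • x ∉ C)
include hC hd

lemma swap_smul_of_mem {x : X} (hx : x ∈ C) : swap T C • x = T • x := by
  rw [swap, dif_pos ⟨hC, hd⟩]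
  exact (exists_swap T hC hd).choose_spec.1 x hx

lemma swap_smul_of_inv_mem {x : X} (hx : T⁻¹ • x ∈ C) : swap T C • x = T⁻¹ • x := by
  rw [swap, dif_pos ⟨hC, hd⟩]
  exact (exists_swap T hC hd).choose_spec.2.1 x hx

lemma swap_smul_smul {x : X} (hx : x ∈ C) : swap T C • T • x = x := by
  rw [swap_smul_of_inv_mem hC hd (by simpa using hx), inv_smul_smul]

lemma swap_smul_of_notMem {x : X} (hx : x ∉ C) (hx' : T⁻¹ • x ∉ C) : swap T C • x = x := by
  rw [swap, dif_pos ⟨hC, hd⟩]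
  exact (exists_swap T hC hd).choose_spec.2.2 x hx hx'

lemma swap_involutive (x : X) : swap T C • swap T C • x = x := by
  by_cases hx : x ∈ C
  · rw [swap_smul_of_mem hC hd hx, swap_smul_smul hC hd hx]
  · by_cases hx' : T⁻¹ • x ∈ C
    · rw [swap_smul_of_inv_mem hC hd hx', swap_smul_of_mem hC hd hx', smul_inv_smul]
    · rw [swap_smul_of_notMem hC hd hx hx', swap_smul_of_notMem hC hd hx hx']

end swap

/-! ### A countable group with the same orbits -/

open Classical in
/-- Every `φ ∈ Φ` coincides on `{x ∈ A | φ x ∉ A}` with an element of the full group: the involution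
which exchanges this set with its image. -/
lemma exists_exact_of_mem [IsFiniteMeasure μ] {φ : PartialIso μ} (hφ : φ ∈ Φ.carrier) {A : Set X}
    (hA : MeasurableSet A) :
    ∃ U : Φ.exact, ∀ x : φ.dom, (x : X) ∈ A → (φ.toEquiv x : X) ∉ A →
      U • (x : X) = φ.toEquiv x := by
  let f : X → X := fun x => if h : x ∈ φ.dom then φ.toEquiv ⟨x, h⟩ else x
  let g : X → X := fun x => if h : x ∈ φ.rng then φ.toEquiv.symm ⟨x, h⟩ else x
  have hf : Measurable f := Measurable.dite (g := fun x : (φ.domᶜ : Set X) => (x : X))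
    (measurable_subtype_coe.comp φ.toEquiv.measurable) measurable_subtype_coe φ.measurableSet_dom
  have hg : Measurable g := Measurable.dite (g := fun x : (φ.rngᶜ : Set X) => (x : X))
    (measurable_subtype_coe.comp φ.toEquiv.symm.measurable) measurable_subtype_coe
    φ.measurableSet_rng
  have hfd : ∀ x : φ.dom, f x = φ.toEquiv x := fun x => by simp [f]
  have hgr : ∀ x : φ.rng, g x = φ.toEquiv.symm x := fun x => by simp [g]
  let E : Set X := φ.dom ∩ (A ∩ f ⁻¹' Aᶜ)
  let F : Set X := φ.rng ∩ (Aᶜ ∩ g ⁻¹' A)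
  have h1 : ∀ x ∈ E, f x ∈ F ∧ g (f x) = x := by
    rintro x ⟨hx, hxA, hxA'⟩
    have e1 := hfd ⟨x, hx⟩
    have e2 := hgr (φ.toEquiv ⟨x, hx⟩)
    simp only [MeasurableEquiv.symm_apply_apply] at e2
    have e3 : g (f x) = x := by rw [e1, e2]
    exact ⟨⟨by rw [e1]; exact Subtype.coe_prop _, hxA', by rwa [mem_preimage, e3]⟩, e3⟩
  have h2 : ∀ x ∈ F, g x ∈ E ∧ f (g x) = x := by
    rintro x ⟨hx, hxA, hxA'⟩
    have e1 := hgr ⟨x, hx⟩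
    have e2 := hfd (φ.toEquiv.symm ⟨x, hx⟩)
    simp only [MeasurableEquiv.apply_symm_apply] at e2
    have e3 : f (g x) = x := by rw [e1, e2]
    exact ⟨⟨by rw [e1]; exact Subtype.coe_prop _, hxA', by rwa [mem_preimage, e3]⟩, e3⟩
  have hE : MeasurableSet E := φ.measurableSet_dom.inter (hA.inter (hf hA.compl))
  have hF : MeasurableSet F := φ.measurableSet_rng.inter (hA.compl.inter (hg hA))
  obtain ⟨U, hU1, hU2, hU3⟩ := exists_exchange (μ := μ) hE hF
    (disjoint_left.2 fun x hx hx' => hx'.2.1 hx.2.1) hf hg h1 h2 (fun S hS => by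
      have hm : MeasurableSet (Subtype.val ⁻¹' (F ∩ S) : Set φ.rng) :=
        measurable_subtype_coe (hF.inter hS)
      have := φ.measurePreserving.measure_preimage hm.nullMeasurableSet
      rw [comap_subtype_coe_apply φ.measurableSet_dom, comap_subtype_coe_apply φ.measurableSet_rng,
        Subtype.image_preimage_coe, inter_eq_right.2 (inter_subset_left.trans inter_subset_left)]
        at this
      rw [← this]
      congr 1
      ext x
      constructor
      · rintro ⟨hx, hxS⟩
        have := (h1 x hx).1
        have e1 := hfd ⟨x, hx.1⟩
        refine ⟨⟨x, hx.1⟩, ?_, rfl⟩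
        simp only [mem_preimage, mem_inter_iff, ← e1]
        exact ⟨this, hxS⟩
      · rintro ⟨⟨y, hy⟩, hyS, rfl⟩
        simp only [mem_preimage, ← hfd] at hyS
        have := h2 _ hyS.1
        have e3 : g (f y) = y := by
          have e2 := hgr (φ.toEquiv ⟨y, hy⟩)
          simp only [MeasurableEquiv.symm_apply_apply] at e2
          rw [hfd ⟨y, hy⟩, e2]
        rw [e3] at this
        exact ⟨this.1, hyS.2⟩)
  have hrel : ∀ x ∈ φ.dom, Φ.rel x (f x) := fun x hx => ⟨φ, hφ, hx, (hfd ⟨x, hx⟩).symm⟩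
  have hU : ∀ x, U.1 x = x ∨ Φ.rel x (U.1 x) ∨ Φ.rel (U.1 x) x := by
    intro x
    by_cases hx : x ∈ E
    · rw [hU1 x hx]; exact Or.inr (Or.inl (hrel x hx.1))
    · by_cases hx' : x ∈ F
      · rw [hU2 x hx']
        have := hrel _ (h2 x hx').1.1
        rw [(h2 x hx').2] at this
        exact Or.inr (Or.inr this)
      · exact Or.inl (hU3 x hx hx')
  refine ⟨⟨U, mem_exact_of (fun x => ?_) (lt_of_le_of_lt (lintegral_mono
    (g := fun _ => (1 : ℝ≥0∞)) fun x => ?_) ?_)⟩, fun x hx hx' => ?_⟩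
  · rcases hU x with h | h | h
    · rw [h]
    · exact Relation.EqvGen.rel _ _ h
    · exact Φ.orbitRel.symm (Relation.EqvGen.rel _ _ h)
  · rcases hU x with h | h
    · rw [h, d_self]; exact zero_le
    · exact d_le_one_of_rel h
  · simp
  · rw [← hfd]
    exact hU1 x ⟨x.2, hx, by rwa [mem_preimage, hfd]⟩

/-- Some countable subgroup of the full group has the same orbits as the graphing. -/
theorem exists_countable_subgroup [IsFiniteMeasure μ] (Φ : Graphing μ) :
    ∃ Γ : Subgroup Φ.exact, Countable Γ ∧ ∀ x y, Φ.orbitRel x y ↔ ∃ g ∈ Γ, g • x = y := by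
  obtain ⟨A, hA, hsep⟩ := exists_countable_separating X
  have _ := Φ.countable.to_subtype
  choose u hu using fun (φ : Φ.carrier) (i : ℕ × Bool) => exists_exact_of_mem φ.2 (hA i)
  refine ⟨(FreeGroup.lift fun p : Φ.carrier × (ℕ × Bool) => u p.1 p.2).range, ?_,
    fun x y => ⟨fun h => ?_, ?_⟩⟩
  · exact (MonoidHom.rangeRestrict_surjective _).countable
  · induction h with
    | rel x y h =>
      obtain ⟨φ, hφ, hx, rfl⟩ := h
      by_cases hxy : x = φ.toEquiv ⟨x, hx⟩
      · exact ⟨1, one_mem _, by rw [one_smul]; exact hxy⟩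
      · obtain ⟨i, h1, h2⟩ := hsep _ _ hxy
        exact ⟨u ⟨φ, hφ⟩ i, ⟨FreeGroup.of (⟨φ, hφ⟩, i), by simp⟩,
          hu ⟨φ, hφ⟩ i ⟨x, hx⟩ h1 h2⟩
    | refl x => exact ⟨1, one_mem _, one_smul _ x⟩
    | symm x y _ ih =>
      obtain ⟨g, hg, rfl⟩ := ih
      exact ⟨g⁻¹, inv_mem hg, inv_smul_smul g x⟩
    | trans x y z _ _ ih1 ih2 =>
      obtain ⟨g, hg, rfl⟩ := ih1
      obtain ⟨h, hh, rfl⟩ := ih2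
      exact ⟨h * g, mul_mem hh hg, mul_smul h g x⟩
  · rintro ⟨g, -, rfl⟩
    exact orbitRel_smul g x

theorem measurableSet_saturation [IsFiniteMeasure μ] {B : Set X} (hB : MeasurableSet B) :
    MeasurableSet (Φ.saturation B) := by
  obtain ⟨Γ, hΓ, horb⟩ := exists_countable_subgroup Φ
  have : Φ.saturation B = ⋃ g : Γ, {x | (g : Φ.exact) • x ∈ B} := by
    ext y
    simp only [mem_iUnion]
    constructor
    · rintro ⟨x, hx, hxy⟩
      obtain ⟨g, hg, rfl⟩ := (horb y x).1 (Φ.orbitRel.symm hxy)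
      exact ⟨⟨g, hg⟩, hx⟩
    · rintro ⟨g, hg⟩
      exact ⟨_, hg, Φ.orbitRel.symm (orbitRel_smul _ _)⟩
  rw [this]
  exact MeasurableSet.iUnion fun g => measurableSet_preimage_smul _ hB

/-! ### From transformations to classes -/

/-- The homomorphism mapping a transformation to its class. -/
def toFull (Φ : Graphing μ) : Φ.exact →* Φ.fullGroup :=
  ((QuotientGroup.mk' (nullAut μ)).comp Φ.exact.subtype).codRestrict Φ.fullGroup fun T => T.2.2

lemma edist_toFull (S T : Φ.exact) :
    edist (Φ.toFull S) (Φ.toFull T) = ∫⁻ x : X, Φ.d (S • x) (T • x) ∂μ := rfl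

lemma toFull_eq_iff {S T : Φ.exact} :
    Φ.toFull S = Φ.toFull T ↔ ∀ᵐ x ∂μ, S • x = T • x := by
  rw [Subtype.ext_iff]
  exact mk_eq_iff S.1 T.1

/-- Every class has a representative which preserves every orbit. -/
theorem toFull_surjective [IsFiniteMeasure μ] (Φ : Graphing μ) :
    Function.Surjective Φ.toFull := by
  rintro ⟨_, T, hT, rfl⟩
  obtain ⟨Γ, hΓ, horb⟩ := exists_countable_subgroup Φ
  let _ := upgradeStandardBorel X
  let Y : Set X := {x | Φ.orbitRel x (T.1 x)}
  have hY : MeasurableSet Y := by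
    have : Y = ⋃ g : Γ, {x | (g : Φ.exact) • x = T.1 x} := by
      ext x
      simp only [mem_iUnion]
      exact (horb _ _).trans ⟨fun ⟨g, hg, h⟩ => ⟨⟨g, hg⟩, h⟩, fun ⟨g, h⟩ => ⟨g, g.2, h⟩⟩
    rw [this]
    exact MeasurableSet.iUnion fun g =>
      measurableSet_eq_fun (measurable_smul _) (PreAut.measurable T)
  -- the restriction of `T` to the largest `T`-invariant subset of `Y` is the desired representative
  let Z : Set X := ⋂ n : ℤ, {x | (T ^ n).1 x ∈ Y}
  have hZ : MeasurableSet Z := MeasurableSet.iInter fun n => PreAut.measurable (T ^ n) hY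
  have hZinv : ∀ x, T.1 x ∈ Z ↔ x ∈ Z := by
    intro x
    have key : ∀ n : ℤ, (T ^ n).1 (T.1 x) = (T ^ (n + 1)).1 x := fun n => by
      rw [zpow_add_one]; rfl
    simp only [Z, mem_iInter, mem_ofPred_eq, key]
    exact ⟨fun h n => by simpa using h (n - 1), fun h n => h (n + 1)⟩
  have hZY : Z ⊆ Y := fun x hx => by simpa using mem_iInter.1 hx 0
  have hZae : ∀ᵐ x ∂μ, x ∈ Z := by
    simp only [Z, mem_iInter]
    exact ae_all_iff.2 fun n => (T ^ n).2.1.quasiMeasurePreserving.ae hT.1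
  obtain ⟨U, hU1, hU2⟩ := exists_restrict T hZ hZinv
  have hUT : ∀ᵐ x ∂μ, U.1 x = T.1 x := hZae.mono fun x hx => hU1 x hx
  refine ⟨⟨U, mem_exact_of (fun x => ?_) ?_⟩, Subtype.ext ((mk_eq_iff U T).2 hUT)⟩
  · by_cases hx : x ∈ Z
    · rw [hU1 x hx]; exact hZY hx
    · rw [hU2 x hx]
  · refine lt_of_eq_of_lt (lintegral_congr_ae ?_) hT.2
    filter_upwards [hUT] with x hx
    rw [hx]

/-- Closed subgroups of the `L¹` full group, described through representatives. -/
def L1Closed (H : Subgroup Φ.exact) : Prop :=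
  ∀ T : Φ.exact, (∀ ε > 0, ∃ S ∈ H, ∫⁻ x : X, Φ.d (S • x) (T • x) ∂μ < ε) → T ∈ H

lemma l1Closed_comap {N : Subgroup Φ.fullGroup} (hN : IsClosed (N : Set Φ.fullGroup)) :
    L1Closed (N.comap Φ.toFull) := by
  intro T hT
  have : Φ.toFull T ∈ closure (N : Set Φ.fullGroup) := by
    refine EMetric.mem_closure_iff.2 fun ε hε => ?_
    obtain ⟨S, hS, h⟩ := hT ε hε
    exact ⟨Φ.toFull S, hS, by rwa [edist_comm, edist_toFull]⟩
  rwa [hN.closure_eq] at this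

lemma isClosed_of_l1Closed [IsFiniteMeasure μ] {N : Subgroup Φ.fullGroup}
    (h : L1Closed (N.comap Φ.toFull)) : IsClosed (N : Set Φ.fullGroup) := by
  refine isClosed_of_closure_subset fun T hT => ?_
  obtain ⟨T, rfl⟩ := toFull_surjective Φ T
  refine h T fun ε hε => ?_
  obtain ⟨S, hS, hd⟩ := EMetric.mem_closure_iff.1 hT ε hε
  obtain ⟨S, rfl⟩ := toFull_surjective Φ S
  exact ⟨S, hS, by rwa [edist_comm, edist_toFull] at hd⟩

lemma L1Closed.mem_of_ae_eq {H : Subgroup Φ.exact} (hH : L1Closed H) {S T : Φ.exact} (hS : S ∈ H)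
    (h : ∀ᵐ x ∂μ, S • x = T • x) : T ∈ H := by
  refine hH T fun ε hε => ⟨S, hS, ?_⟩
  rwa [← edist_toFull, toFull_eq_iff.2 h, edist_self]

/-! ### Recurrence in aperiodic graphings -/

/-- A set which meets every orbit at most once is null: its translates by the countably many
elements of a group with the same orbits would include infinitely many disjoint copies of it. -/
theorem measure_eq_zero_of_transversal [IsFiniteMeasure μ] (hap : Φ.Aperiodic) {E : Set X}
    (hE : MeasurableSet E) (ht : ∀ x ∈ E, ∀ y ∈ E, Φ.orbitRel x y → x = y) : μ E = 0 := by
  obtain ⟨Γ, hΓ, horb⟩ := exists_countable_subgroup Φ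
  obtain ⟨e, he⟩ := exists_surjective_nat Γ
  let _ := upgradeStandardBorel X
  let g : ℕ → Φ.exact := fun n => e n
  -- the points of `E` at which `g n` is the first to reach its value
  let F : ℕ → Set X := fun n => {x | x ∈ E ∧ ∀ m < n, g m • x ≠ g n • x}
  have hF : ∀ n, MeasurableSet (F n) := fun n => by
    have : F n = E ∩ ⋂ m ∈ Set.Iio n, {x | g m • x = g n • x}ᶜ := by
      ext x; simp [F]
    rw [this]
    exact hE.inter (MeasurableSet.biInter (to_countable _) fun m _ =>
      (measurableSet_eq_fun (measurable_smul _) (measurable_smul _)).compl)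
  have hdisj : Pairwise (Function.onFun Disjoint fun n => {y | (g n)⁻¹ • y ∈ F n}) := by
    have key : ∀ m n, m < n → Disjoint {y | (g m)⁻¹ • y ∈ F m} {y | (g n)⁻¹ • y ∈ F n} := by
      intro m n hmn
      refine disjoint_left.2 fun y hm hn => ?_
      have : (g n)⁻¹ • y = (g m)⁻¹ • y := ht _ hn.1 _ hm.1
        (Φ.orbitRel.trans (Φ.orbitRel.symm (orbitRel_smul _ y)) (orbitRel_smul _ y))
      refine hn.2 m hmn ?_
      rw [smul_inv_smul, this, smul_inv_smul]
    intro m n hmn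
    rcases hmn.lt_or_gt with h | h
    · exact key m n h
    · exact (key n m h).symm
  have hsum : ∑' n, μ (F n) ≠ ∞ := by
    have : ∀ n, μ (F n) = μ {y | (g n)⁻¹ • y ∈ F n} := fun n =>
      (measure_preimage_smul _ (hF n)).symm
    simp only [this]
    rw [← measure_iUnion hdisj fun n => measurableSet_preimage_smul _ (hF n)]
    exact measure_ne_top _ _
  have hfin : ∀ᵐ x ∂μ, {n | x ∈ F n}.Finite := ae_finite_setOfPred_mem hsum
  have : ∀ᵐ x ∂μ, x ∉ E := by
    filter_upwards [hfin, hap] with x hx hinf hxE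
    refine hinf ((hx.image fun n => g n • x).subset fun y hy => ?_)
    obtain ⟨γ, hγ, rfl⟩ := (horb x y).1 hy
    obtain ⟨n, hn⟩ := he ⟨γ, hγ⟩
    classical
    have hex : ∃ n, g n • x = γ • x := ⟨n, by simp [g, hn]⟩
    refine ⟨Nat.find hex, ⟨hxE, fun m hm h => Nat.find_min hex hm ?_⟩, Nat.find_spec hex⟩
    exact h.trans (Nat.find_spec hex)
  simpa [ae_iff] using this

/-- Almost every orbit which meets `B` meets it infinitely often: otherwise, the minima of the
finite traces, in a Borel linear order, would form a non-null transversal. -/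
theorem ae_infinite_inter [IsFiniteMeasure μ] (hap : Φ.Aperiodic) {B : Set X}
    (hB : MeasurableSet B) :
    ∀ᵐ x ∂μ, x ∈ Φ.saturation B → {y | Φ.orbitRel x y ∧ y ∈ B}.Infinite := by
  obtain ⟨Γ, hΓ, horb⟩ := exists_countable_subgroup Φ
  obtain ⟨f, hf⟩ := exists_measurableEmbedding_real X
  let E : Set X := {x | x ∈ B ∧ ∀ g : Γ, (g : Φ.exact) • x ∈ B → f x ≤ f ((g : Φ.exact) • x)}
  have hE : MeasurableSet E := by
    have : E = B ∩ ⋂ g : Γ, ({x | (g : Φ.exact) • x ∈ B}ᶜ ∪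
        {x | f x ≤ f ((g : Φ.exact) • x)}) := by
      ext x; simp [E, imp_iff_not_or]
    rw [this]
    exact hB.inter (MeasurableSet.iInter fun g => (measurableSet_preimage_smul _ hB).compl.union
      (measurableSet_le hf.measurable (hf.measurable.comp (measurable_smul _))))
  have hE0 : μ E = 0 := by
    refine measure_eq_zero_of_transversal hap hE fun x hx y hy hxy => hf.injective (le_antisymm ?_ ?_)
    · obtain ⟨g, hg, rfl⟩ := (horb x y).1 hxy
      exact hx.2 ⟨g, hg⟩ hy.1
    · obtain ⟨g, hg, rfl⟩ := (horb y x).1 (Φ.orbitRel.symm hxy)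
      exact hy.2 ⟨g, hg⟩ hx.1
  have hae : ∀ᵐ x ∂μ, ∀ g : Γ, (g : Φ.exact) • x ∉ E := by
    refine ae_all_iff.2 fun g => (measurePreserving_smul (g : Φ.exact)).quasiMeasurePreserving.ae
      (p := fun y => y ∉ E) ?_
    simpa [ae_iff] using hE0
  filter_upwards [hae] with x hx hxB hfin
  obtain ⟨z, hz, hzx⟩ := hxB
  obtain ⟨y, ⟨hy, hyB⟩, hmin⟩ := Set.exists_min_image _ f hfin ⟨z, Φ.orbitRel.symm hzx, hz⟩
  obtain ⟨g, hg, rfl⟩ := (horb x y).1 hy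
  exact hx ⟨g, hg⟩ ⟨hyB, fun h hhB =>
    hmin _ ⟨Φ.orbitRel.trans (orbitRel_smul _ _) (orbitRel_smul _ _), hhB⟩⟩

/-! ### Involutions in closed subgroups -/

lemma mul_comm_of_disjoint_support {S T : Φ.exact} (P : Set X) (hS : ∀ x, S • x ≠ x → x ∈ P)
    (hT : ∀ x, T • x ≠ x → x ∉ P) : S * T = T * S := by
  ext x
  rw [mul_smul, mul_smul]
  by_cases hx : x ∈ P
  · have h1 : T • x = x := by_contra fun h => hT x h hx
    by_cases h2 : S • x = x
    · rw [h1, h2, h1]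
    · have h3 : S • x ∈ P := hS _ fun h => h2 (smul_left_cancel S h)
      rw [h1, by_contra fun h => hT _ h h3]
  · have h1 : S • x = x := by_contra fun h => hx (hS x h)
    by_cases h2 : T • x = x
    · rw [h1, h2, h1]
    · have h3 : T • x ∉ P := hT _ fun h => h2 (smul_left_cancel T h)
      rw [h1, by_contra fun h => h3 (hS _ h)]

/-- If the restrictions of `T` to the members of a disjoint sequence of invariant sets lie in a
closed subgroup, so does the restriction to their union. -/
lemma L1Closed.restr_iUnion_mem {H : Subgroup Φ.exact} (hH : L1Closed H) {T : Φ.exact}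
    {C : ℕ → Set X} (hC : ∀ n, MeasurableSet (C n)) (hinv : ∀ n x, T • x ∈ C n ↔ x ∈ C n)
    (hmem : ∀ n, restr T (C n) ∈ H) (hdisj : Pairwise (Function.onFun Disjoint C)) :
    restr T (⋃ n, C n) ∈ H := by
  let A : ℕ → Set X := fun N => ⋃ n < N, C n
  have hA : ∀ N, MeasurableSet (A N) := fun N =>
    MeasurableSet.biUnion (to_countable _) fun n _ => hC n
  have hAinv : ∀ N x, T • x ∈ A N ↔ x ∈ A N := fun N x => by simp [A, hinv]
  have hU : MeasurableSet (⋃ n, C n) := MeasurableSet.iUnion hC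
  have hUinv : ∀ x, T • x ∈ ⋃ n, C n ↔ x ∈ ⋃ n, C n := fun x => by simp [hinv]
  have hAmem : ∀ N, restr T (A N) ∈ H := by
    intro N
    induction N with
    | zero =>
      convert one_mem H
      ext x
      rw [restr_smul_of_notMem (hA 0) (hAinv 0) (by simp [A]), one_smul]
    | succ N ih =>
      convert mul_mem ih (hmem N)
      ext x
      have hs : A (N + 1) = A N ∪ C N := biUnion_lt_succ C N
      rw [mul_smul]
      by_cases hx : x ∈ C N
      · have hx' : T • x ∉ A N := by
          rw [hAinv]
          simp only [A, mem_iUnion, not_exists]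
          exact fun n hn h => disjoint_left.1 (hdisj hn.ne) h hx
        rw [restr_smul_of_mem (hA _) (hAinv _) (by rw [hs]; exact Or.inr hx),
          restr_smul_of_mem (hC N) (hinv N) hx, restr_smul_of_notMem (hA N) (hAinv N) hx']
      · rw [restr_smul_of_notMem (hC N) (hinv N) hx]
        by_cases hx' : x ∈ A N
        · rw [restr_smul_of_mem (hA _) (hAinv _) (by rw [hs]; exact Or.inl hx'),
            restr_smul_of_mem (hA N) (hAinv N) hx']
        · rw [restr_smul_of_notMem (hA _) (hAinv _) (by rw [hs]; exact not_or.2 ⟨hx', hx⟩),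
            restr_smul_of_notMem (hA N) (hAinv N) hx']
  refine hH _ fun ε hε => ?_
  have hlim : Tendsto (fun N => ∫⁻ x : X, Φ.d (restr T (A N) • x) (restr T (⋃ n, C n) • x) ∂μ)
      atTop (𝓝 (∫⁻ _ : X, 0 ∂μ)) := by
    refine tendsto_lintegral_of_dominated_convergence (fun x => Φ.d x (T • x))
      (fun N => measurable_d_smul _ _) (fun N => Eventually.of_forall fun x => ?_)
      (lintegral_d_smul_lt_top T).ne (Eventually.of_forall fun x => ?_)
    · dsimp only
      by_cases hx : x ∈ A N
      · rw [restr_smul_of_mem (hA N) (hAinv N) hx, restr_smul_of_mem hU hUinv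
          (iUnion₂_subset (fun n _ => subset_iUnion C n) hx), d_self]
        exact zero_le
      · rw [restr_smul_of_notMem (hA N) (hAinv N) hx]
        by_cases hx' : x ∈ ⋃ n, C n
        · rw [restr_smul_of_mem hU hUinv hx']
        · rw [restr_smul_of_notMem hU hUinv hx', d_self]
          exact zero_le
    · refine tendsto_const_nhds.congr' ?_
      by_cases hx : x ∈ ⋃ n, C n
      · obtain ⟨n, hn⟩ := mem_iUnion.1 hx
        filter_upwards [eventually_gt_atTop n] with N hN
        rw [restr_smul_of_mem (hA N) (hAinv N) (mem_iUnion₂.2 ⟨n, hN, hn⟩),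
          restr_smul_of_mem hU hUinv hx, d_self]
      · refine Eventually.of_forall fun N => ?_
        dsimp only
        rw [restr_smul_of_notMem (hA N) (hAinv N) fun h =>
          hx (iUnion₂_subset (fun n _ => subset_iUnion C n) h),
          restr_smul_of_notMem hU hUinv hx, d_self]
  rw [lintegral_zero] at hlim
  obtain ⟨N, hN⟩ := (hlim.eventually (gt_mem_nhds hε)).exists
  exact ⟨_, hAmem N, hN⟩

/-- A transformation lies in a closed subgroup as soon as it does so locally. -/
theorem L1Closed.mem_of_local [IsFiniteMeasure μ] {H : Subgroup Φ.exact} (hH : L1Closed H)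
    {U : Φ.exact}
    (hloc : ∀ E : Set X, MeasurableSet E → μ E ≠ 0 → (∀ x ∈ E, U • x ∉ E) →
      ∃ D, MeasurableSet D ∧ (∀ x, U • x ∈ D ↔ x ∈ D) ∧ (∀ x ∈ D, x ∈ E ∨ U • x ∈ E) ∧
        μ D ≠ 0 ∧ restr U D ∈ H) : U ∈ H := by
  obtain ⟨C, ⟨hC, hCinv, hCH⟩, hmax⟩ := exists_exhausting (μ := μ)
    (fun C => MeasurableSet C ∧ (∀ x, U • x ∈ C ↔ x ∈ C) ∧ restr U C ∈ H)
    (by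
      refine ⟨MeasurableSet.empty, by simp, ?_⟩
      convert one_mem H
      ext x
      rw [restr_smul_of_notMem MeasurableSet.empty (by simp) (notMem_empty x), one_smul])
    (fun C h => h.1)
    (fun C h hd => ⟨MeasurableSet.iUnion fun n => (h n).1, fun x => by simp [(h _).2.1],
      hH.restr_iUnion_mem (fun n => (h n).1) (fun n => (h n).2.1) (fun n => (h n).2.2) hd⟩)
  have h0 : μ ({x | U • x ≠ x} \ C) = 0 := by
    by_contra h0
    obtain ⟨E, hEsub, hE, hE0, hEd⟩ := exists_subset_disjoint_images
      ((measurableSet_support U).diff hC) h0 (measurable_smul U) measurable_id fun x hx => hx.1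
    obtain ⟨D, hD, hDinv, hDE, hD0, hDH⟩ := hloc E hE hE0 fun x hx h => hEd x hx _ h rfl
    refine hD0 (hmax D ⟨hD, hDinv, hDH⟩ (disjoint_left.2 fun x hx hxC => ?_))
    rcases hDE x hx with h | h
    · exact (hEsub h).2 hxC
    · exact (hEsub h).2 ((hCinv x).2 hxC)
  refine hH.mem_of_ae_eq hCH ?_
  filter_upwards [measure_eq_zero_iff_ae_notMem.1 h0] with x hx
  by_cases hxC : x ∈ C
  · exact restr_smul_of_mem hC hCinv hxC
  · rw [restr_smul_of_notMem hC hCinv hxC]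
    by_contra h
    exact hx ⟨fun h' => h h'.symm, hxC⟩

/-- A non-null set `E` has a non-null subset which some element of the full group moves inside `E`
off itself. -/
lemma exists_subset_smul_mem [IsFiniteMeasure μ] (hap : Φ.Aperiodic) {E : Set X}
    (hE : MeasurableSet E) (h0 : μ E ≠ 0) :
    ∃ g : Φ.exact, ∃ E' ⊆ E, MeasurableSet E' ∧ μ E' ≠ 0 ∧
      ∀ x ∈ E', g • x ∈ E ∧ g • x ∉ E' := by
  obtain ⟨Γ, hΓ, horb⟩ := exists_countable_subgroup Φ
  let F : Γ → Set X := fun g => E ∩ ({x | (g : Φ.exact) • x ∈ E} ∩ {x | (g : Φ.exact) • x ≠ x})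
  have hF : ∀ g, MeasurableSet (F g) := fun g =>
    hE.inter ((measurableSet_preimage_smul _ hE).inter (measurableSet_support _))
  obtain ⟨g, hg⟩ : ∃ g, μ (F g) ≠ 0 := by
    by_contra! hcon
    refine h0 ?_
    have h1 : ∀ᵐ x ∂μ, ∀ g, x ∉ F g :=
      ae_all_iff.2 fun g => measure_eq_zero_iff_ae_notMem.1 (hcon g)
    rw [measure_eq_zero_iff_ae_notMem]
    filter_upwards [h1, ae_infinite_inter hap hE] with x hx hinf hxE
    obtain ⟨y, ⟨hy, hyE⟩, hyx⟩ :=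
      ((hinf (subset_saturation E hxE)).sdiff (finite_singleton x)).nonempty
    obtain ⟨g, hg, rfl⟩ := (horb x y).1 hy
    exact hx ⟨g, hg⟩ ⟨hxE, hyE, hyx⟩
  obtain ⟨E', h1, h2, h3, h4⟩ := exists_subset_disjoint_images (hF g) hg
    (measurable_smul (g : Φ.exact)) measurable_id fun x hx => hx.2.2
  exact ⟨g, E', h1.trans inter_subset_left, h2, h3,
    fun x hx => ⟨(h1 hx).2.1, fun h => h4 x hx _ h rfl⟩⟩

/-- Locally, an involution `U` of an aperiodic full group is a commutator: if `c` exchanges two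
disjoint subsets `E₁` and `E₂` of `E`, then the restriction of `U` to `E₁ ∪ U E₁` and its conjugate
by `c (U c U)` have as a product the restriction of `U` to `E₁ ∪ E₂ ∪ U E₁ ∪ U E₂`. -/
theorem exists_restr_eq_commutator [IsFiniteMeasure μ] (hap : Φ.Aperiodic) {U : Φ.exact}
    (hU : ∀ x : X, U • U • x = x) {E : Set X} (hE : MeasurableSet E) (h0 : μ E ≠ 0)
    (hEU : ∀ x ∈ E, U • x ∉ E) :
    ∃ (D : Set X) (a b : Φ.exact), MeasurableSet D ∧ (∀ x, U • x ∈ D ↔ x ∈ D) ∧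
      (∀ x ∈ D, x ∈ E ∨ U • x ∈ E) ∧ μ D ≠ 0 ∧ restr U D = a * b * a⁻¹ * b⁻¹ ∧
      (∀ x : X, a • a • x = x) ∧ (∀ x, a • x ≠ x → x ∈ E ∨ U • x ∈ E) ∧
      (∀ x : X, b • b • x = x) ∧ (∀ x, b • x ≠ x → x ∈ E ∨ U • x ∈ E) := by
  obtain ⟨g, E1, hE1, hE1m, hE10, hg⟩ := exists_subset_smul_mem hap hE h0
  have hgd : ∀ x ∈ E1, g • x ∉ E1 := fun x hx => (hg x hx).2
  let c := swap g E1
  have hc : ∀ x : X, c • c • x = x := swap_involutive hE1m hgd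
  have hcE : ∀ x, c • x ≠ x → x ∈ E := by
    intro x hx
    by_contra hxE
    refine hx (swap_smul_of_notMem hE1m hgd (fun h => hxE (hE1 h)) fun h => hxE ?_)
    simpa using (hg _ h).1
  have hcE' : ∀ x ∈ E, c • x ∈ E := by
    intro x hx
    by_contra h
    have h' : c • c • x = c • x := by_contra fun h' => h (hcE _ h')
    rw [hc] at h'
    exact h (h' ▸ hx)
  have hUU : U * U = 1 := by ext x; rw [mul_smul, hU, one_smul]
  have hcc : c * c = 1 := by ext x; rw [mul_smul, hc, one_smul]
  have hcomm : c * (U * c * U) = U * c * U * c := by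
    refine mul_comm_of_disjoint_support E hcE fun x hx hxE => hx ?_
    have : c • U • x = U • x := by_contra fun h => hEU x hxE (hcE _ h)
    rw [mul_smul, mul_smul, this, hU]
  let a : Φ.exact := c * (U * c * U)
  have haU : a * U = U * a := by
    change c * (U * c * U) * U = U * (c * (U * c * U))
    rw [hcomm]
    calc U * c * U * c * U = U * (c * U * c * U) := by group
      _ = U * (c * (U * c * U)) := by group
      _ = _ := by rw [hcomm]
  have haU' : ∀ x : X, a • U • x = U • a • x := fun x => by rw [← mul_smul, haU, mul_smul]
  have ha : ∀ x : X, a • a • x = x := by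
    have : a * a = 1 := by
      calc a * a = c * (U * c * U) * (U * c * U * c) := by rw [← hcomm]
        _ = c * (U * c * (U * U) * c * U) * c := by group
        _ = c * (U * (c * c) * U) * c := by rw [hUU]; group
        _ = 1 := by rw [hcc, mul_one, hUU, mul_one, hcc]
    intro x
    rw [← mul_smul, this, one_smul]
  have haE : ∀ x ∈ E, a • x = c • x := by
    intro x hx
    have : c • U • x = U • x := by_contra fun h => hEU x hx (hcE _ h)
    change (c * (U * c * U)) • x = _
    rw [mul_smul, mul_smul, mul_smul, this, hU]
  have haN : ∀ x, a • x ≠ x → x ∈ E ∨ U • x ∈ E := by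
    intro x hx
    by_contra! h
    have h1 : c • U • x = U • x := by_contra fun h' => h.2 (hcE _ h')
    have h2 : c • x = x := by_contra fun h' => h.1 (hcE _ h')
    refine hx ?_
    change (c * (U * c * U)) • x = _
    rw [mul_smul, mul_smul, mul_smul, h1, hU, h2]
  let C : Set X := {x | x ∈ E1 ∨ U • x ∈ E1}
  have hC : MeasurableSet C := hE1m.union (measurableSet_preimage_smul U hE1m)
  have hCU : ∀ x, U • x ∈ C ↔ x ∈ C := fun x => by
    change U • x ∈ E1 ∨ U • U • x ∈ E1 ↔ x ∈ E1 ∨ U • x ∈ E1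
    rw [hU, or_comm]
  have haC1 : ∀ x ∈ E1, a • x ∉ C := by
    intro x hx
    rw [haE x (hE1 hx), show c • x = g • x from swap_smul_of_mem hE1m hgd hx]
    rintro (h | h)
    · exact (hg x hx).2 h
    · exact hEU _ (hg x hx).1 (hE1 h)
  have haC : ∀ x ∈ C, a • x ∉ C := by
    rintro x (hx | hx)
    · exact haC1 x hx
    · have := haC1 _ hx
      rwa [haU', hCU] at this
  let b := restr U C
  have hb : ∀ x : X, b • b • x = x := restr_involutive hU hC hCU
  have hb1 : ∀ x ∈ C, b • x = U • x := fun x hx => restr_smul_of_mem hC hCU hx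
  have hb2 : ∀ x, x ∉ C → b • x = x := fun x hx => restr_smul_of_notMem hC hCU hx
  let D : Set X := C ∪ {x | a • x ∈ C}
  have hD : MeasurableSet D := hC.union (measurableSet_preimage_smul a hC)
  have hDU : ∀ x, U • x ∈ D ↔ x ∈ D := fun x => by
    change U • x ∈ C ∨ a • U • x ∈ C ↔ x ∈ C ∨ a • x ∈ C
    rw [haU', hCU, hCU]
  have hCE : ∀ x ∈ C, x ∈ E ∨ U • x ∈ E := fun x hx => hx.imp (fun h => hE1 h) (fun h => hE1 h)
  refine ⟨D, a, b, hD, hDU, ?_, ?_, ?_, ha, haN, hb, fun x hx => hCE x ?_⟩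
  · rintro x (hx | hx)
    · exact hCE x hx
    · by_contra h
      have : a • x = x := by_contra fun h' => h (haN x h')
      rw [mem_ofPred_eq, this] at hx
      exact h (hCE x hx)
  · exact fun h => hE10 (measure_mono_null (fun x hx => Or.inl (Or.inl hx)) h)
  · have ha' : a⁻¹ = a := inv_eq_of_mul_eq_one_right (by ext x; rw [mul_smul, ha, one_smul])
    have hb' : b⁻¹ = b := inv_eq_of_mul_eq_one_right (by ext x; rw [mul_smul, hb, one_smul])
    ext x
    rw [ha', hb', mul_smul, mul_smul, mul_smul]
    by_cases hx : x ∈ C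
    · rw [restr_smul_of_mem hD hDU (Or.inl hx), hb1 x hx, hb2 _ (haC _ ((hCU x).2 hx)), ha]
    · rw [hb2 x hx]
      by_cases hx' : a • x ∈ C
      · rw [restr_smul_of_mem hD hDU (Or.inr hx'), hb1 _ hx', haU', ha]
      · rw [restr_smul_of_notMem hD hDU (not_or.2 ⟨hx, hx'⟩), hb2 _ hx', ha]
  · exact by_contra fun h => hx (hb2 x h)

/-- A closed subgroup which contains the commutators of all pairs of involutions supported in `B`
contains all involutions supported in `B`. -/
theorem L1Closed.involution_mem_of_commutators [IsFiniteMeasure μ] (hap : Φ.Aperiodic)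
    {H : Subgroup Φ.exact} (hH : L1Closed H) {B : Set X}
    (hcomm : ∀ a b : Φ.exact, (∀ x : X, a • a • x = x) → (∀ x, a • x ≠ x → x ∈ B) →
      (∀ x : X, b • b • x = x) → (∀ x, b • x ≠ x → x ∈ B) → a * b * a⁻¹ * b⁻¹ ∈ H)
    {U : Φ.exact} (hU : ∀ x : X, U • U • x = x) (hUB : ∀ x, U • x ≠ x → x ∈ B) : U ∈ H := by
  refine hH.mem_of_local fun E hE h0 hEU => ?_
  obtain ⟨D, a, b, hD, hDU, hDE, hD0, hab, ha, haE, hb, hbE⟩ :=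
    exists_restr_eq_commutator hap hU hE h0 hEU
  have hEB : ∀ x, x ∈ E ∨ U • x ∈ E → x ∈ B := by
    rintro x (hx | hx)
    · exact hUB x fun h => hEU x hx (by rwa [h])
    · refine hUB x fun h => ?_
      rw [h] at hx
      exact hEU x hx (by rwa [h])
  exact ⟨D, hD, hDU, hDE, hD0, hab ▸ hcomm a b ha (fun x hx => hEB x (haE x hx)) hb
    fun x hx => hEB x (hbE x hx)⟩

/-! ### Normal subgroups contain many involutions -/

/-- If `S` moves `B` off itself, then `⁅⁅U, S⁆, V⁆ = ⁅U, V⁆` for all `U` and `V` supported in `B`. -/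
lemma commutator_mem_of_smul_disjoint {H K : Subgroup Φ.exact}
    (hnorm : ∀ P ∈ K, ∀ S ∈ H, P * S * P⁻¹ ∈ H) {S : Φ.exact} (hS : S ∈ H) {B : Set X}
    (hSB : ∀ x ∈ B, S • x ∉ B) {U V : Φ.exact} (hU : U ∈ K) (hUB : ∀ x, U • x ≠ x → x ∈ B)
    (hV : V ∈ K) (hVB : ∀ x, V • x ≠ x → x ∈ B) : U * V * U⁻¹ * V⁻¹ ∈ H := by
  have hW : U * S * U⁻¹ * S⁻¹ ∈ H := mul_mem (hnorm U hU S hS) (inv_mem hS)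
  have hW' := mul_mem hW (hnorm V hV _ (inv_mem hW))
  have hcomm : V * (S * U⁻¹ * S⁻¹) = S * U⁻¹ * S⁻¹ * V := by
    refine mul_comm_of_disjoint_support B hVB fun x hx hxB => ?_
    have h1 : U⁻¹ • S⁻¹ • x ≠ S⁻¹ • x := fun h => hx (by
      rw [mul_smul, mul_smul, h, smul_inv_smul])
    have h2 : S⁻¹ • x ∈ B := hUB _ fun h => h1 (inv_smul_eq_iff.2 h.symm)
    exact hSB _ h2 (by rwa [smul_inv_smul])
  convert hW' using 1
  calc U * V * U⁻¹ * V⁻¹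
      = U * (V * (S * U⁻¹ * S⁻¹)) * (S * U⁻¹ * S⁻¹)⁻¹ * U⁻¹ * V⁻¹ := by group
    _ = U * S * U⁻¹ * S⁻¹ * (V * (U * S * U⁻¹ * S⁻¹)⁻¹ * V⁻¹) := by rw [hcomm]; group

/-- Let `H` be a closed subgroup normalized by a group `K` containing all involutions. If some
element of `H` moves `B` off itself, then `H` contains all the involutions supported in the
saturation of `B`: locally, these are conjugate to involutions supported in `B`. -/
theorem L1Closed.involution_mem_of_saturation [IsFiniteMeasure μ] (hap : Φ.Aperiodic)
    {H K : Subgroup Φ.exact} (hH : L1Closed H)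
    (hK : ∀ U : Φ.exact, (∀ x : X, U • U • x = x) → U ∈ K)
    (hnorm : ∀ P ∈ K, ∀ S ∈ H, P * S * P⁻¹ ∈ H) {S : Φ.exact} (hS : S ∈ H) {B : Set X}
    (hB : MeasurableSet B) (hSB : ∀ x ∈ B, S • x ∉ B) {U : Φ.exact} (hU : ∀ x : X, U • U • x = x)
    (hUB : ∀ x, U • x ≠ x → x ∈ Φ.saturation B) : U ∈ H := by
  have hin : ∀ V : Φ.exact, (∀ x : X, V • V • x = x) → (∀ x, V • x ≠ x → x ∈ B) → V ∈ H :=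
    fun V hV hVB => hH.involution_mem_of_commutators hap (fun a b ha haB hb hbB =>
      commutator_mem_of_smul_disjoint hnorm hS hSB (hK a ha) haB (hK b hb) hbB) hV hVB
  let _ := upgradeStandardBorel X
  obtain ⟨Γ, hΓ, horb⟩ := exists_countable_subgroup Φ
  refine hH.mem_of_local fun E hE h0 hEU => ?_
  -- two elements mapping part of `E` to different places in `B`
  let F : Γ × Γ → Set X := fun p => E ∩ ({x | (p.1 : Φ.exact) • x ∈ B} ∩
    ({x | (p.2 : Φ.exact) • x ∈ B} ∩ ({x | (p.1 : Φ.exact) • x ≠ x} ∩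
    ({x | (p.2 : Φ.exact) • x ≠ x} ∩ ({x | (p.2 : Φ.exact) • x = U • x}ᶜ ∩
    {x | (p.2 : Φ.exact) • x = (p.1 : Φ.exact) • x}ᶜ)))))
  have hF : ∀ p, MeasurableSet (F p) := fun p =>
    hE.inter ((measurableSet_preimage_smul _ hB).inter ((measurableSet_preimage_smul _ hB).inter
      ((measurableSet_support _).inter ((measurableSet_support _).inter
        ((measurableSet_eq_fun (measurable_smul _) (measurable_smul _)).compl.inter
          (measurableSet_eq_fun (measurable_smul _) (measurable_smul _)).compl)))))
  obtain ⟨⟨g, h⟩, hgh⟩ : ∃ p, μ (F p) ≠ 0 := by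
    by_contra! hcon
    refine h0 ?_
    have h1 : ∀ᵐ x ∂μ, ∀ p, x ∉ F p :=
      ae_all_iff.2 fun p => measure_eq_zero_iff_ae_notMem.1 (hcon p)
    rw [measure_eq_zero_iff_ae_notMem]
    filter_upwards [h1, ae_infinite_inter hap hB] with x hx hinf hxE
    have hinf := hinf (hUB x fun h => hEU x hxE (by rwa [h]))
    obtain ⟨y, ⟨hy, hyB⟩, hyx⟩ := (hinf.sdiff (finite_singleton x)).nonempty
    obtain ⟨z, ⟨hz, hzB⟩, hzx⟩ := (hinf.sdiff (toFinite {x, U • x, y})).nonempty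
    obtain ⟨g, hg, rfl⟩ := (horb x y).1 hy
    obtain ⟨h, hh, rfl⟩ := (horb x z).1 hz
    simp only [mem_insert_iff, mem_singleton_iff, not_or] at hzx
    exact hx (⟨g, hg⟩, ⟨h, hh⟩) ⟨hxE, hyB, hzB, hyx, hzx.1, hzx.2.1, hzx.2.2⟩
  obtain ⟨E', hE'F, hE', hE'0, hne⟩ := exists_subset_disjoint_images_list (hF (g, h)) hgh
    [(fun x => (g : Φ.exact) • x, id), (fun x => (h : Φ.exact) • x, id),
      (fun x => (h : Φ.exact) • x, fun x => U • x),
      (fun x => (h : Φ.exact) • x, fun x => (g : Φ.exact) • x)]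
    (by simp [measurable_smul, measurable_id])
    (by
      simp only [List.mem_cons, List.not_mem_nil, or_false, forall_eq_or_imp, forall_eq]
      exact ⟨fun x hx => hx.2.2.2.1, fun x hx => hx.2.2.2.2.1, fun x hx => hx.2.2.2.2.2.1,
        fun x hx => hx.2.2.2.2.2.2⟩)
  simp only [List.mem_cons, List.not_mem_nil, or_false, forall_eq_or_imp, forall_eq, id] at hne
  obtain ⟨n1, n2, n3, n4⟩ := hne
  have hUE' : ∀ x ∈ E', U • x ∉ E' := fun x hx hx' => hEU x (hE'F hx).1 (hE'F hx').1
  let G : Set X := {x | U • x ∈ E'}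
  have hG : MeasurableSet G := measurableSet_preimage_smul U hE'
  have hgd : ∀ x ∈ E', (g : Φ.exact) • x ∉ E' := fun x hx hx' => n1 x hx _ hx' rfl
  have hhd : ∀ x ∈ G, ((h : Φ.exact) * U) • x ∉ G := fun x hx hx' => by
    refine n3 (U • x) hx _ hx' ?_
    rw [hU, mul_smul]
  -- `P` maps `E'` into `B` through `g`, and `U E'` into `B` through `h`
  let P : Φ.exact := swap (g : Φ.exact) E' * swap ((h : Φ.exact) * U) G
  have hP : P ∈ K := mul_mem (hK _ (swap_involutive hE' hgd)) (hK _ (swap_involutive hG hhd))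
  let D : Set X := E' ∪ G
  have hD : MeasurableSet D := hE'.union hG
  have hDU : ∀ x, U • x ∈ D ↔ x ∈ D := fun x => by
    change U • x ∈ E' ∨ U • U • x ∈ E' ↔ x ∈ E' ∨ U • x ∈ E'
    rw [hU, or_comm]
  have hPD : ∀ x ∈ D, P • x ∈ B := by
    rintro x (hx | hx)
    · have h1 : swap ((h : Φ.exact) * U) G • x = x :=
        swap_smul_of_notMem hG hhd (hUE' x hx) fun hx' => by
          refine n2 _ hx' x hx ?_
          rw [← mul_smul, smul_inv_smul]
      rw [mul_smul, h1, swap_smul_of_mem hE' hgd hx]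
      exact (hE'F hx).2.1
    · have h2 : swap (g : Φ.exact) E' • (h : Φ.exact) • U • x = (h : Φ.exact) • U • x :=
        swap_smul_of_notMem hE' hgd (fun hx' => n2 _ hx _ hx' rfl) fun hx' =>
          n4 _ hx _ hx' (smul_inv_smul _ _).symm
      rw [mul_smul, swap_smul_of_mem hG hhd hx, mul_smul, h2]
      exact (hE'F hx).2.2.1
  refine ⟨D, hD, hDU, fun x hx => hx.imp (fun h => (hE'F h).1) fun h => (hE'F h).1,
    fun h => hE'0 (measure_mono_null subset_union_left h), ?_⟩
  have hV : P * restr U D * P⁻¹ ∈ H := by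
    refine hin _ (fun x => ?_) fun x hx => ?_
    · simp only [mul_smul, inv_smul_smul, restr_involutive hU hD hDU, smul_inv_smul]
    · have h1 : P⁻¹ • x ∈ D := by
        by_contra h1
        refine hx ?_
        rw [mul_smul, mul_smul, restr_smul_of_notMem hD hDU h1, smul_inv_smul]
      simpa using hPD _ h1
  have := hnorm P⁻¹ (inv_mem hP) _ hV
  rwa [inv_inv, show P⁻¹ * (P * restr U D * P⁻¹) * P = restr U D by group] at this

/-! ### Commutators are limits of products of involutions -/

/-- A fixed-point-free set contains at least a third of its measure in a set `C` disjoint from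
`T C`, obtained greedily. -/
lemma exists_subset_smul_notMem (T : Φ.exact) {B : Set X} (hB : MeasurableSet B)
    (hBT : ∀ x ∈ B, T • x ≠ x) :
    ∃ C ⊆ B, MeasurableSet C ∧ (∀ x ∈ C, T • x ∉ C) ∧ μ B ≤ 3 * μ C := by
  obtain ⟨A, hA, hsep⟩ := exists_countable_separating X
  obtain ⟨e, he⟩ := exists_surjective_nat (ℕ × Bool)
  -- the `n`-th step adds the points separated from their image by `A (e n)` that do not conflict
  -- with the set already built
  let G : ℕ → Set X := fun n => Nat.rec ∅ (fun n G => G ∪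
    ((B ∩ (A (e n) ∩ {x | T • x ∈ (A (e n))ᶜ})) \ (G ∪ ({x | T • x ∈ G} ∪ {x | T⁻¹ • x ∈ G})))) n
  have hGs : ∀ n, G (n + 1) = G n ∪ ((B ∩ (A (e n) ∩ {x | T • x ∈ (A (e n))ᶜ})) \
      (G n ∪ ({x | T • x ∈ G n} ∪ {x | T⁻¹ • x ∈ G n}))) := fun n => rfl
  have hmono : Monotone G := monotone_nat_of_le_succ fun n => by
    rw [hGs]; exact subset_union_left
  have hGm : ∀ n, MeasurableSet (G n) := by
    intro n
    induction n with
    | zero => exact MeasurableSet.empty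
    | succ n ih =>
      rw [hGs]
      exact ih.union ((hB.inter ((hA _).inter (measurableSet_preimage_smul T (hA _).compl))).diff
        (ih.union ((measurableSet_preimage_smul T ih).union (measurableSet_preimage_smul T⁻¹ ih))))
  have hGB : ∀ n, G n ⊆ B := by
    intro n
    induction n with
    | zero => exact empty_subset _
    | succ n ih => rw [hGs]; exact union_subset ih fun x hx => hx.1.1
  have hGT : ∀ n, ∀ x ∈ G n, T • x ∉ G n := by
    intro n
    induction n with
    | zero => exact fun x hx => absurd hx (notMem_empty x)
    | succ n ih =>
      rw [hGs]
      rintro x (hx | hx) (hx' | hx')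
      · exact ih x hx hx'
      · exact hx'.2 (Or.inr (Or.inr (by simpa using hx)))
      · exact hx.2 (Or.inr (Or.inl hx'))
      · exact hx.1.2.2 hx'.1.2.1
  let C := ⋃ n, G n
  have hC : MeasurableSet C := MeasurableSet.iUnion hGm
  refine ⟨C, iUnion_subset hGB, hC, fun x hx hx' => ?_, ?_⟩
  · obtain ⟨m, hm⟩ := mem_iUnion.1 hx
    obtain ⟨n, hn⟩ := mem_iUnion.1 hx'
    exact hGT (max m n) x (hmono (le_max_left m n) hm) (hmono (le_max_right m n) hn)
  · have hcov : B ⊆ C ∪ ({x | T • x ∈ C} ∪ {x | T⁻¹ • x ∈ C}) := by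
      intro x hx
      obtain ⟨i, h1, h2⟩ := hsep x (T • x) (hBT x hx).symm
      obtain ⟨n, rfl⟩ := he i
      rcases em (x ∈ G n ∪ ({y : X | T • y ∈ G n} ∪ {y : X | T⁻¹ • y ∈ G n})) with h | h
      · rcases h with h | h | h
        · exact Or.inl (mem_iUnion.2 ⟨n, h⟩)
        · exact Or.inr (Or.inl (mem_iUnion.2 ⟨n, h⟩))
        · exact Or.inr (Or.inr (mem_iUnion.2 ⟨n, h⟩))
      · exact Or.inl (mem_iUnion.2 ⟨n + 1, by rw [hGs]; exact Or.inr ⟨⟨hx, h1, h2⟩, h⟩⟩)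
    calc μ B ≤ μ C + (μ {x | T • x ∈ C} + μ {x | T⁻¹ • x ∈ C}) :=
          (measure_mono hcov).trans ((measure_union_le _ _).trans
            (add_le_add le_rfl (measure_union_le _ _)))
      _ = 3 * μ C := by
        rw [measure_preimage_smul T hC, measure_preimage_smul T⁻¹ hC]; ring

section swap_mul

variable {T : Φ.exact} {C : Set X} (hC : MeasurableSet C) (hd : ∀ x ∈ C, T • x ∉ C)
include hC hd

lemma swap_mul_smul_of_mem {x : X} (hx : x ∈ C) : (swap T C * T) • x = x := by
  rw [mul_smul, swap_smul_smul hC hd hx]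

lemma swap_mul_smul_of_eq {x : X} (hx : T • x = x) : (swap T C * T) • x = x := by
  have h1 : x ∉ C := fun h => hd x h (by rwa [hx])
  rw [mul_smul, hx, swap_smul_of_notMem hC hd h1]
  rwa [inv_smul_eq_iff.2 hx.symm]

/-- `swap T C * T` is the transformation induced by `T` on the complement of `C`, extended by the
identity: an orbit which enters `C` leaves it at the next step. Its displacement is therefore
controlled by the one of `T`. -/
lemma setLIntegral_d_swap_mul_le {A : Set X} (hA : MeasurableSet A) (hCA : C ⊆ A) :
    ∫⁻ x in A, Φ.d x ((swap T C * T) • x) ∂μ ≤ ∫⁻ x in A, Φ.d x (T • x) ∂μ := by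
  have hm := measurable_d_self_smul T
  have hAC : MeasurableSet (A \ C) := hA.diff hC
  calc ∫⁻ x in A, Φ.d x ((swap T C * T) • x) ∂μ
      = ∫⁻ x, A.indicator (fun x => Φ.d x ((swap T C * T) • x)) x ∂μ :=
        (lintegral_indicator hA _).symm
    _ ≤ ∫⁻ x, ((A \ C).indicator (fun x => Φ.d x (T • x)) x +
          C.indicator (fun x => Φ.d x (T • x)) (T • x)) ∂μ := by
        refine lintegral_mono fun x => ?_
        by_cases hxA : x ∈ A
        · rw [indicator_of_mem hxA]
          by_cases hx : x ∈ C
          · rw [swap_mul_smul_of_mem hC hd hx, d_self]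
            exact zero_le
          · rw [indicator_of_mem (show x ∈ A \ C from ⟨hxA, hx⟩)]
            by_cases hx' : T • x ∈ C
            · rw [indicator_of_mem hx', mul_smul, swap_smul_of_mem hC hd hx']
              exact Φ.d_triangle _ _ _
            · rw [mul_smul, swap_smul_of_notMem hC hd hx' (by rwa [inv_smul_smul])]
              exact le_self_add
        · rw [indicator_of_notMem hxA]
          exact zero_le
    _ = ∫⁻ x in A \ C, Φ.d x (T • x) ∂μ + ∫⁻ x in C, Φ.d x (T • x) ∂μ := by
        rw [lintegral_add_left (hm.indicator hAC), lintegral_smul T (hm.indicator hC),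
          lintegral_indicator hAC, lintegral_indicator hC]
    _ = ∫⁻ x in A, Φ.d x (T • x) ∂μ := by
        rw [← lintegral_union hC disjoint_sdiff_left, sdiff_union_of_subset hCA]

end swap_mul

/-- Modulo involutions, `T` can be modified so as to fix most points of a given set `A`. -/
theorem exists_mul_inv_mem_measure_support_lt [IsFiniteMeasure μ] {H : Subgroup Φ.exact}
    (hinv : ∀ U : Φ.exact, (∀ x : X, U • U • x = x) → U ∈ H) (T : Φ.exact) {A : Set X}
    (hA : MeasurableSet A) {δ : ℝ≥0∞} (hδ : 0 < δ) :
    ∃ T' : Φ.exact, T' * T⁻¹ ∈ H ∧ (∀ x : X, T' • x ≠ x → T • x ≠ x) ∧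
      μ (A ∩ {x | T' • x ≠ x}) < δ ∧
      ∫⁻ x in A, Φ.d x (T' • x) ∂μ ≤ ∫⁻ x in A, Φ.d x (T • x) ∂μ := by
  -- each step removes a third of the remaining part of the support
  let r : ℝ≥0∞ := 3⁻¹ * 2
  have hr : r < 1 := by
    have : r = 2 / 3 := by rw [ENNReal.div_eq_inv_mul]
    rw [this]
    exact ENNReal.div_lt_of_lt_mul (by norm_num)
  have key : ∀ n : ℕ, ∃ T' : Φ.exact, T' * T⁻¹ ∈ H ∧ (∀ x : X, T' • x ≠ x → T • x ≠ x) ∧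
      μ (A ∩ {x | T' • x ≠ x}) ≤ r ^ n * μ univ ∧
      ∫⁻ x in A, Φ.d x (T' • x) ∂μ ≤ ∫⁻ x in A, Φ.d x (T • x) ∂μ := by
    intro n
    induction n with
    | zero =>
      exact ⟨T, by simp, fun x hx => hx, by simpa using measure_mono (subset_univ _), le_rfl⟩
    | succ n ih =>
      obtain ⟨S, h1, h2, h3, h4⟩ := ih
      have hB : MeasurableSet (A ∩ {x | S • x ≠ x}) := hA.inter (measurableSet_support S)
      obtain ⟨C, hCB, hC, hd, hC3⟩ := exists_subset_smul_notMem S hB fun x hx => hx.2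
      refine ⟨swap S C * S, ?_, fun x hx => h2 x fun h => hx (swap_mul_smul_of_eq hC hd h), ?_,
        (setLIntegral_d_swap_mul_le hC hd hA fun x hx => (hCB hx).1).trans h4⟩
      · rw [mul_assoc]
        exact mul_mem (hinv _ (swap_involutive hC hd)) h1
      · have hsub : A ∩ {x | (swap S C * S) • x ≠ x} ⊆ (A ∩ {x | S • x ≠ x}) \ C :=
          fun x hx => ⟨⟨hx.1, fun h => hx.2 (swap_mul_smul_of_eq hC hd h)⟩,
            fun h => hx.2 (swap_mul_smul_of_mem hC hd h)⟩
        have hadd := measure_sdiff_add_inter (μ := μ) (A ∩ {x | S • x ≠ x}) hC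
        rw [inter_eq_right.2 hCB] at hadd
        have h5 : 3 * μ ((A ∩ {x | S • x ≠ x}) \ C) ≤ 2 * μ (A ∩ {x | S • x ≠ x}) := by
          refine (ENNReal.add_le_add_iff_right (a := 3 * μ C)
            (ENNReal.mul_ne_top (by simp) (measure_ne_top _ _))).1 ?_
          rw [← mul_add, hadd]
          calc 3 * μ (A ∩ {x | S • x ≠ x})
              = 2 * μ (A ∩ {x | S • x ≠ x}) + μ (A ∩ {x | S • x ≠ x}) := by ring
            _ ≤ _ := add_le_add le_rfl hC3
        calc μ (A ∩ {x | (swap S C * S) • x ≠ x})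
            ≤ μ ((A ∩ {x | S • x ≠ x}) \ C) := measure_mono hsub
          _ = 3⁻¹ * (3 * μ ((A ∩ {x | S • x ≠ x}) \ C)) := by
              rw [← mul_assoc, ENNReal.inv_mul_cancel (by simp) (by simp), one_mul]
          _ ≤ 3⁻¹ * (2 * μ (A ∩ {x | S • x ≠ x})) := by gcongr
          _ = r * μ (A ∩ {x | S • x ≠ x}) := by rw [← mul_assoc]
          _ ≤ r * (r ^ n * μ univ) := by gcongr
          _ = r ^ (n + 1) * μ univ := by rw [pow_succ]; ring
  have hlim : Tendsto (fun n => r ^ n * μ univ) atTop (𝓝 0) := by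
    simpa using ENNReal.Tendsto.mul_const (ENNReal.tendsto_pow_atTop_nhds_zero_of_lt_one hr)
      (Or.inr (measure_ne_top μ univ))
  obtain ⟨n, hn⟩ := (hlim.eventually (gt_mem_nhds hδ)).exists
  obtain ⟨T', h1, h2, h3, h4⟩ := key n
  exact ⟨T', h1, h2, h3.trans_lt hn, h4⟩

/-- Two transformations almost commute when their displacements are small on the intersection of
their supports. -/
lemma lintegral_d_mul_mul_le (T U : Φ.exact) :
    ∫⁻ x, Φ.d ((T * U) • x) ((U * T) • x) ∂μ ≤
      2 * (∫⁻ x in {x | T • x ≠ x} ∩ {x | U • x ≠ x}, Φ.d x (T • x) ∂μ +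
        ∫⁻ x in {x | T • x ≠ x} ∩ {x | U • x ≠ x}, Φ.d x (U • x) ∂μ) := by
  set C : Set X := {x | T • x ≠ x} ∩ {x | U • x ≠ x}
  have hC : MeasurableSet C := (measurableSet_support T).inter (measurableSet_support U)
  let f : X → ℝ≥0∞ := C.indicator fun x => Φ.d x (T • x)
  let g : X → ℝ≥0∞ := C.indicator fun x => Φ.d x (U • x)
  have hf : Measurable f := (measurable_d_self_smul T).indicator hC
  have hg : Measurable g := (measurable_d_self_smul U).indicator hC
  have h1 : ∀ x, (U • x ≠ x ∨ T • x = x) → Φ.d (U • x) (T • U • x) ≤ f (U • x) := by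
    intro x hx
    by_cases h : T • U • x = U • x
    · rw [h, d_self]; exact zero_le
    · have : U • x ∈ C := by
        refine ⟨h, fun h' => ?_⟩
        have h'' : U • x = x := smul_left_cancel U h'
        rcases hx with hx | hx
        · exact hx h''
        · exact h (by rw [h'', hx])
      exact (indicator_of_mem this (fun x => Φ.d x (T • x))).ge
  have h2 : ∀ x, (T • x ≠ x ∨ U • x = x) → Φ.d (T • x) (U • T • x) ≤ g (T • x) := by
    intro x hx
    by_cases h : U • T • x = T • x
    · rw [h, d_self]; exact zero_le
    · have : T • x ∈ C := by
        refine ⟨fun h' => ?_, h⟩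
        have h'' : T • x = x := smul_left_cancel T h'
        rcases hx with hx | hx
        · exact hx h''
        · exact h (by rw [h'', hx])
      exact (indicator_of_mem this (fun x => Φ.d x (U • x))).ge
  have hpt : ∀ x, Φ.d ((T * U) • x) ((U * T) • x) ≤ f (U • x) + (g x + (f x + g (T • x))) := by
    intro x
    rw [mul_smul, mul_smul]
    by_cases hx : x ∈ C
    · have e1 : f x = Φ.d x (T • x) := indicator_of_mem hx _
      have e2 : g x = Φ.d x (U • x) := indicator_of_mem hx _
      rw [e1, e2, Φ.d_comm x (U • x)]
      refine (Φ.d_triangle _ (U • x) _).trans (add_le_add ?_ ?_)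
      · rw [d_comm]; exact h1 x (Or.inl hx.2)
      · refine (Φ.d_triangle _ x _).trans (add_le_add le_rfl ?_)
        exact (Φ.d_triangle _ (T • x) _).trans (add_le_add le_rfl (h2 x (Or.inl hx.1)))
    · by_cases hT : T • x = x
      · rw [hT, d_comm]
        exact (h1 x (Or.inr hT)).trans le_self_add
      · have hU : U • x = x := by_contra fun h => hx ⟨hT, h⟩
        rw [hU]
        exact (h2 x (Or.inr hU)).trans (le_add_self.trans (le_add_self.trans le_add_self))
  refine (lintegral_mono hpt).trans (le_of_eq ?_)
  rw [lintegral_add_left (f := fun x => f (U • x)) (hf.comp (measurable_smul U)),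
    lintegral_add_left hg,
    lintegral_add_left hf, lintegral_smul U hf, lintegral_smul T hg, lintegral_indicator hC,
    lintegral_indicator hC]
  ring

/-- Modulo the involutions, any two elements can be given almost disjoint supports, so that they
almost commute. -/
theorem L1Closed.commutator_mem [IsFiniteMeasure μ] {H : Subgroup Φ.exact} [H.Normal]
    (hH : L1Closed H) (hinv : ∀ U : Φ.exact, (∀ x : X, U • U • x = x) → U ∈ H) (T U : Φ.exact) :
    T * U * T⁻¹ * U⁻¹ ∈ H := by
  refine hH _ fun ε hε => ?_
  obtain ⟨η, hη, hηε⟩ : ∃ η : ℝ≥0∞, 0 < η ∧ 2 * (η + η) < ε := by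
    have h0 : min ε 1 ≠ 0 := (lt_min hε zero_lt_one).ne'
    have ht : min ε 1 ≠ ∞ := ne_top_of_le_ne_top ENNReal.one_ne_top (min_le_right _ _)
    refine ⟨min ε 1 / 5, ENNReal.div_pos h0 (by simp), lt_of_lt_of_le ?_ (min_le_left ε 1)⟩
    calc 2 * (min ε 1 / 5 + min ε 1 / 5) = 4 * (min ε 1 / 5) := by ring
      _ < 4 * (min ε 1 / 5) + min ε 1 / 5 :=
        ENNReal.lt_add_right (ENNReal.mul_ne_top (by simp) (ENNReal.div_ne_top ht (by simp)))
          (ENNReal.div_pos h0 (by simp)).ne'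
      _ = 5 * (min ε 1 / 5) := by ring
      _ = min ε 1 := ENNReal.mul_div_cancel (by simp) (by simp)
  obtain ⟨δ, hδ, hδT⟩ := exists_pos_setLIntegral_lt_of_measure_lt
    (lintegral_d_smul_lt_top T).ne hη.ne'
  obtain ⟨U', hU'H, hU'U, hU'μ, -⟩ := exists_mul_inv_mem_measure_support_lt hinv U
    (measurableSet_support T) hδ
  have hC : MeasurableSet ({x : X | T • x ≠ x} ∩ {x | U' • x ≠ x}) :=
    (measurableSet_support T).inter (measurableSet_support U')
  obtain ⟨δ', hδ', hδU⟩ := exists_pos_setLIntegral_lt_of_measure_lt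
    (lintegral_d_smul_lt_top U').ne hη.ne'
  obtain ⟨T', hT'H, hT'T, hT'μ, hT'd⟩ := exists_mul_inv_mem_measure_support_lt hinv T hC hδ'
  have hsub : {x : X | T' • x ≠ x} ∩ {x | U' • x ≠ x} ⊆
      ({x : X | T • x ≠ x} ∩ {x | U' • x ≠ x}) ∩ {x | T' • x ≠ x} :=
    fun x hx => ⟨⟨hT'T x hx.1, hx.2⟩, hx.1⟩
  have e1 : ∫⁻ x in {x | T' • x ≠ x} ∩ {x | U' • x ≠ x}, Φ.d x (T' • x) ∂μ ≤ η :=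
    (lintegral_mono_set (hsub.trans inter_subset_left)).trans (hT'd.trans (hδT _ hU'μ).le)
  have e2 : ∫⁻ x in {x | T' • x ≠ x} ∩ {x | U' • x ≠ x}, Φ.d x (U' • x) ∂μ ≤ η :=
    (hδU _ ((measure_mono hsub).trans_lt hT'μ)).le
  -- `Z` is close to the identity and congruent to the given commutator modulo `H`
  let Z : Φ.exact := T' * U' * T'⁻¹ * U'⁻¹
  have hmk : ∀ {S S' : Φ.exact}, S' * S⁻¹ ∈ H → (S' : Φ.exact ⧸ H) = S := fun {S S'} h => by
    have h' : ((S' * S⁻¹ : Φ.exact) : Φ.exact ⧸ H) = 1 := (QuotientGroup.eq_one_iff _).2 h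
    rw [QuotientGroup.mk_mul, QuotientGroup.mk_inv, mul_inv_eq_one] at h'
    exact h'
  have hZ : Z⁻¹ * (T * U * T⁻¹ * U⁻¹) ∈ H := by
    refine QuotientGroup.eq.1 ?_
    simp only [Z, QuotientGroup.mk_mul, QuotientGroup.mk_inv, hmk hT'H, hmk hU'H]
  refine ⟨_, hZ, ?_⟩
  calc ∫⁻ x, Φ.d ((Z⁻¹ * (T * U * T⁻¹ * U⁻¹)) • x) ((T * U * T⁻¹ * U⁻¹) • x) ∂μ
      = ∫⁻ x, (fun y : X => Φ.d y (Z • y)) ((Z⁻¹ * (T * U * T⁻¹ * U⁻¹)) • x) ∂μ := by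
        refine lintegral_congr fun x => ?_
        simp only [← mul_smul, mul_inv_cancel_left]
    _ = ∫⁻ x, (fun y : X => Φ.d y (Z • y)) ((U' * T') • x) ∂μ := by
        rw [lintegral_smul _ (measurable_d_self_smul Z), lintegral_smul _ (measurable_d_self_smul Z)]
    _ = ∫⁻ x, Φ.d ((T' * U') • x) ((U' * T') • x) ∂μ := by
        refine lintegral_congr fun x => ?_
        have : Z * (U' * T') = T' * U' := by simp only [Z]; group
        simp only [← mul_smul, this, d_comm _ ((T' * U') • x)]
    _ ≤ 2 * (η + η) := (lintegral_d_mul_mul_le T' U').trans (by gcongr)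
    _ < ε := hηε

/-! ### The closure of the derived group -/

lemma l1Closed_derivedClosure : L1Closed (Φ.derivedClosure.comap Φ.toFull) :=
  l1Closed_comap (Subgroup.isClosed_topologicalClosure _)

lemma involution_mem_derivedClosure [IsFiniteMeasure μ] (hap : Φ.Aperiodic) {U : Φ.exact}
    (hU : ∀ x : X, U • U • x = x) : Φ.toFull U ∈ Φ.derivedClosure := by
  refine l1Closed_derivedClosure.involution_mem_of_commutators hap (B := univ)
    (fun a b _ _ _ _ => ?_) hU fun x _ => mem_univ x
  refine Subgroup.le_topologicalClosure _ ?_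
  simp only [map_mul, map_inv]
  exact Subgroup.commutator_mem_commutator (Subgroup.mem_top _) (Subgroup.mem_top _)

variable (Φ) in
/-- The group generated by the involutions which preserve every orbit. -/
def involutionGroup : Subgroup Φ.exact :=
  Subgroup.closure {U | ∀ x : X, U • U • x = x}

instance : (involutionGroup Φ).Normal where
  conj_mem S hS P := by
    induction hS using Subgroup.closure_induction with
    | mem U hU =>
      refine Subgroup.subset_closure fun x => ?_
      simp only [mul_smul, inv_smul_smul]
      rw [show U • U • P⁻¹ • x = P⁻¹ • x from hU _, smul_inv_smul]
    | one => simp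
    | mul S T _ _ hS hT =>
      rw [show P * (S * T) * P⁻¹ = P * S * P⁻¹ * (P * T * P⁻¹) by group]
      exact mul_mem hS hT
    | inv S _ hS =>
      rw [show P * S⁻¹ * P⁻¹ = (P * S * P⁻¹)⁻¹ by group]
      exact inv_mem hS

lemma derivedClosure_le [IsFiniteMeasure μ] :
    Φ.derivedClosure ≤ ((involutionGroup Φ).map Φ.toFull).topologicalClosure := by
  refine Subgroup.topologicalClosure_minimal _ ?_ (Subgroup.isClosed_topologicalClosure _)
  have h1 : ((involutionGroup Φ).map Φ.toFull).Normal :=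
    Subgroup.Normal.map inferInstance _ (toFull_surjective Φ)
  have h2 := Subgroup.is_normal_topologicalClosure ((involutionGroup Φ).map Φ.toFull)
  have h3 := h2.comap Φ.toFull
  refine Subgroup.commutator_le.2 fun S _ T _ => ?_
  obtain ⟨S, rfl⟩ := toFull_surjective Φ S
  obtain ⟨T, rfl⟩ := toFull_surjective Φ T
  have := (l1Closed_comap (Subgroup.isClosed_topologicalClosure
    ((involutionGroup Φ).map Φ.toFull))).commutator_mem (fun U hU =>
      Subgroup.le_topologicalClosure _ ⟨U, Subgroup.subset_closure hU, rfl⟩) S T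
  simpa only [Subgroup.mem_comap, map_mul, map_inv, commutatorElement_def] using this

/-- The closure of the derived group is topologically generated by involutions. -/
theorem L1Closed.mem_of_mem_derivedClosure [IsFiniteMeasure μ] {K : Subgroup Φ.exact}
    (hK : L1Closed K) (hinv : ∀ U : Φ.exact, (∀ x : X, U • U • x = x) → U ∈ K) {T : Φ.exact}
    (hT : Φ.toFull T ∈ Φ.derivedClosure) : T ∈ K := by
  refine hK T fun ε hε => ?_
  obtain ⟨_, ⟨S, hS, rfl⟩, hd⟩ := EMetric.mem_closure_iff.1 (derivedClosure_le hT) ε hε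
  refine ⟨S, ?_, by rwa [edist_comm, edist_toFull] at hd⟩
  exact (Subgroup.closure_le K).2 hinv hS

/-! ### Elements supported in an invariant set -/

lemma toFull_mem_supportedIn {T : Φ.exact} {A : Set X} :
    (Φ.toFull T : Aut μ) ∈ supportedIn μ A ↔ ∀ᵐ x ∂μ, T • x ≠ x → x ∈ A := by
  constructor
  · rintro ⟨S, hS, hST⟩
    have hS : ∀ᵐ x ∂μ, S.1 x ≠ x → x ∈ A := hS
    have hST : ∀ᵐ x ∂μ, S.1 x = T • x := (mk_eq_iff S T.1).1 hST
    filter_upwards [hS, hST] with x h1 h2 h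
    exact h1 (by rwa [h2])
  · exact fun h => ⟨T.1, h, rfl⟩

lemma mem_derivedClosureOn {T : Φ.exact} (hT : Φ.toFull T ∈ Φ.derivedClosure) {A : Set X} :
    (⟨Φ.toFull T, hT⟩ : Φ.derivedClosure) ∈ Φ.derivedClosureOn A ↔
      ∀ᵐ x ∂μ, T • x ≠ x → x ∈ A :=
  toFull_mem_supportedIn

lemma exists_rep [IsFiniteMeasure μ] (t : Φ.derivedClosure) :
    ∃ (T : Φ.exact) (hT : Φ.toFull T ∈ Φ.derivedClosure), t = ⟨Φ.toFull T, hT⟩ := by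
  obtain ⟨T, hT⟩ := toFull_surjective Φ t.1
  exact ⟨T, hT ▸ t.2, Subtype.ext hT.symm⟩

lemma restr_mul {A : Set X} (hA : MeasurableSet A) (hinv : Φ.Invariant A) (S T : Φ.exact) :
    restr (S * T) A = restr S A * restr T A := by
  ext x
  rw [mul_smul]
  by_cases hx : x ∈ A
  · rw [restr_smul_of_mem hA (hinv.smul_mem_iff _) hx, restr_smul_of_mem hA (hinv.smul_mem_iff T) hx,
      restr_smul_of_mem hA (hinv.smul_mem_iff S) ((hinv.smul_mem_iff T x).2 hx), mul_smul]
  · rw [restr_smul_of_notMem hA (hinv.smul_mem_iff _) hx,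
      restr_smul_of_notMem hA (hinv.smul_mem_iff T) hx,
      restr_smul_of_notMem hA (hinv.smul_mem_iff S) hx]

/-- Restriction to an invariant set, as a homomorphism. -/
noncomputable def restrHom {A : Set X} (hA : MeasurableSet A) (hinv : Φ.Invariant A) :
    Φ.exact →* Φ.exact :=
  MonoidHom.mk' (fun T => restr T A) (restr_mul hA hinv)

/-- A closed subgroup containing all the involutions supported in an invariant set `A` contains all
the elements of the closure of the derived group supported in `A`. -/
theorem L1Closed.mem_of_support [IsFiniteMeasure μ] {H : Subgroup Φ.exact} (hH : L1Closed H)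
    {A : Set X} (hA : MeasurableSet A) (hinv : Φ.Invariant A)
    (hAH : ∀ U : Φ.exact, (∀ x : X, U • U • x = x) → (∀ x, U • x ≠ x → x ∈ A) → U ∈ H)
    {T : Φ.exact} (hT : Φ.toFull T ∈ Φ.derivedClosure) (hTA : ∀ᵐ x ∂μ, T • x ≠ x → x ∈ A) :
    T ∈ H := by
  have hK : L1Closed (H.comap (restrHom hA hinv)) := by
    intro T hT
    refine hH _ fun ε hε => ?_
    obtain ⟨S, hS, hd⟩ := hT ε hε
    refine ⟨restr S A, hS, lt_of_le_of_lt (lintegral_mono fun x => ?_) hd⟩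
    change Φ.d (restr S A • x) (restr T A • x) ≤ _
    by_cases hx : x ∈ A
    · rw [restr_smul_of_mem hA (hinv.smul_mem_iff _) hx,
        restr_smul_of_mem hA (hinv.smul_mem_iff _) hx]
    · rw [restr_smul_of_notMem hA (hinv.smul_mem_iff _) hx,
        restr_smul_of_notMem hA (hinv.smul_mem_iff _) hx, d_self]
      exact zero_le
  have hres : restr T A ∈ H := hK.mem_of_mem_derivedClosure (fun U hU => by
    refine hAH _ (restr_involutive hU hA (hinv.smul_mem_iff U)) fun x hx => ?_
    by_contra h
    exact hx (restr_smul_of_notMem hA (hinv.smul_mem_iff U) h)) hT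
  refine hH.mem_of_ae_eq hres ?_
  filter_upwards [hTA] with x hx
  by_cases hxA : x ∈ A
  · exact restr_smul_of_mem hA (hinv.smul_mem_iff T) hxA
  · rw [restr_smul_of_notMem hA (hinv.smul_mem_iff T) hxA]
    by_contra h
    exact hxA (hx fun h' => h h'.symm)

lemma exists_involution_ne [IsFiniteMeasure μ] (hap : Φ.Aperiodic) {C : Set X}
    (hC : MeasurableSet C) (h0 : μ C ≠ 0) :
    ∃ U : Φ.exact, (∀ x : X, U • U • x = x) ∧ (∀ x, U • x ≠ x → x ∈ C) ∧
      μ {x | U • x ≠ x} ≠ 0 := by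
  obtain ⟨g, E, hEC, hE, hE0, hg⟩ := exists_subset_smul_mem hap hC h0
  have hd : ∀ x ∈ E, g • x ∉ E := fun x hx => (hg x hx).2
  refine ⟨swap g E, swap_involutive hE hd, fun x hx => ?_, fun h => hE0 (measure_mono_null ?_ h)⟩
  · by_contra hxC
    refine hx (swap_smul_of_notMem hE hd (fun h => hxC (hEC h)) fun h => hxC ?_)
    simpa using (hg _ h).1
  · intro x hx h
    rw [swap_smul_of_mem hE hd hx] at h
    exact hd x hx (by rwa [h])

lemma measure_diff_eq_zero_of_le [IsFiniteMeasure μ] (hap : Φ.Aperiodic) {A B : Set X}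
    (hA : MeasurableSet A) (hB : MeasurableSet B)
    (h : Φ.derivedClosureOn A ≤ Φ.derivedClosureOn B) : μ (A \ B) = 0 := by
  by_contra h0
  obtain ⟨U, hU, hUAB, hU0⟩ := exists_involution_ne hap (hA.diff hB) h0
  have hD := involution_mem_derivedClosure hap hU
  have h1 := (mem_derivedClosureOn hD).1 (h ((mem_derivedClosureOn hD).2
    (Eventually.of_forall fun x hx => (hUAB x hx).1)))
  refine hU0 ?_
  rw [measure_eq_zero_iff_ae_notMem]
  filter_upwards [h1] with x hx hxU
  exact (hUAB x hxU).2 (hx hxU)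

lemma ae_eq_of_derivedClosureOn_eq [IsFiniteMeasure μ] (hap : Φ.Aperiodic) {A B : Set X}
    (hA : MeasurableSet A) (hB : MeasurableSet B)
    (h : Φ.derivedClosureOn A = Φ.derivedClosureOn B) : A =ᵐ[μ] B := by
  have h1 := measure_diff_eq_zero_of_le hap hA hB h.le
  have h2 := measure_diff_eq_zero_of_le hap hB hA h.ge
  rw [measure_eq_zero_iff_ae_notMem] at h1 h2
  filter_upwards [h1, h2] with x h1 h2
  exact propext ⟨fun h => by_contra fun h' => h1 ⟨h, h'⟩, fun h => by_contra fun h' => h2 ⟨h, h'⟩⟩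

lemma normal_derivedClosureOn [IsFiniteMeasure μ] {A : Set X} (hinv : Φ.Invariant A) :
    (Φ.derivedClosureOn A).Normal where
  conj_mem t ht p := by
    obtain ⟨T, hT, rfl⟩ := exists_rep t
    obtain ⟨P, hP, rfl⟩ := exists_rep p
    have hmem : Φ.toFull (P * T * P⁻¹) ∈ Φ.derivedClosure := by
      simpa only [map_mul, map_inv] using mul_mem (mul_mem hP hT) (inv_mem hP)
    have : (⟨Φ.toFull P, hP⟩ * ⟨Φ.toFull T, hT⟩ * (⟨Φ.toFull P, hP⟩)⁻¹ : Φ.derivedClosure) =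
        ⟨Φ.toFull (P * T * P⁻¹), hmem⟩ := Subtype.ext (by simp)
    rw [this, mem_derivedClosureOn]
    filter_upwards [(measurePreserving_smul P⁻¹).quasiMeasurePreserving.ae
      ((mem_derivedClosureOn hT).1 ht)] with x hx h
    refine (hinv.smul_mem_iff P⁻¹ x).1 (hx fun h' => h ?_)
    rw [mul_smul, mul_smul, h', smul_inv_smul]

lemma isClosed_derivedClosureOn [IsFiniteMeasure μ] {A : Set X} (hA : MeasurableSet A) :
    IsClosed (Φ.derivedClosureOn A : Set Φ.derivedClosure) := by
  have h : IsClosed ((supportedIn μ A).comap Φ.fullGroup.subtype : Set Φ.fullGroup) := by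
    refine isClosed_of_l1Closed fun T hT => toFull_mem_supportedIn.2 ?_
    have h0 : ∫⁻ x : X in Aᶜ, Φ.d x (T • x) ∂μ = 0 := by
      refine le_antisymm (le_of_forall_pos_lt_add' fun ε hε => ?_) zero_le
      obtain ⟨S, hS, hd⟩ := hT ε hε
      rw [zero_add]
      refine lt_of_le_of_lt ?_ hd
      rw [← lintegral_indicator hA.compl]
      refine lintegral_mono_ae ?_
      filter_upwards [toFull_mem_supportedIn.1 hS] with x hx
      by_cases hxA : x ∈ A
      · rw [indicator_of_notMem (not_not.2 hxA)]
        exact zero_le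
      · rw [indicator_of_mem (show x ∈ Aᶜ from hxA), by_contra fun h => hxA (hx h)]
    rw [lintegral_eq_zero_iff (measurable_d_self_smul T)] at h0
    filter_upwards [(ae_restrict_iff' hA.compl).1 h0] with x hx h
    by_contra hxA
    exact h (d_eq_zero.1 (hx hxA)).symm
  exact h.preimage continuous_subtype_val

/-! ### Closed normal subgroups -/

/-- Every closed normal subgroup is the subgroup of the elements supported in some invariant set,
namely a largest invariant set `A` such that the subgroup contains all the involutions supported
in `A`. -/
theorem exists_eq_derivedClosureOn [IsFiniteMeasure μ] (hap : Φ.Aperiodic)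
    (N : Subgroup Φ.derivedClosure) (hN : N.Normal) (hNc : IsClosed (N : Set Φ.derivedClosure)) :
    ∃ A : Set X, MeasurableSet A ∧ Φ.Invariant A ∧ N = Φ.derivedClosureOn A := by
  let H : Subgroup Φ.exact := (N.map Φ.derivedClosure.subtype).comap Φ.toFull
  have hmem : ∀ {T : Φ.exact} (hT : Φ.toFull T ∈ Φ.derivedClosure),
      T ∈ H ↔ (⟨Φ.toFull T, hT⟩ : Φ.derivedClosure) ∈ N := by
    intro T hT
    constructor
    · rintro ⟨t, ht, hTt⟩
      have : t = ⟨Φ.toFull T, hT⟩ := Subtype.ext hTt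
      exact this ▸ ht
    · exact fun h => ⟨_, h, rfl⟩
  have hHD : ∀ T ∈ H, Φ.toFull T ∈ Φ.derivedClosure := by
    rintro T ⟨t, -, hTt⟩
    exact hTt ▸ t.2
  have hH : L1Closed H := by
    refine l1Closed_comap ?_
    rw [Subgroup.coe_map]
    exact (Subgroup.isClosed_topologicalClosure
      (commutator Φ.fullGroup)).isClosedEmbedding_subtypeVal.isClosedMap _ hNc
  have hnorm : ∀ P ∈ Φ.derivedClosure.comap Φ.toFull, ∀ S ∈ H, P * S * P⁻¹ ∈ H := by
    intro P hP S hS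
    have h1 := hHD S hS
    have h2 : P * S * P⁻¹ ∈ Φ.derivedClosure.comap Φ.toFull :=
      mul_mem (mul_mem hP h1) (inv_mem hP)
    rw [hmem h2]
    convert hN.conj_mem _ ((hmem h1).1 hS) ⟨Φ.toFull P, hP⟩
    exact Subtype.ext (by simp)
  obtain ⟨A, ⟨hA, hAinv, hAH⟩, hmax⟩ := exists_exhausting (μ := μ)
    (fun A => MeasurableSet A ∧ Φ.Invariant A ∧
      ∀ U : Φ.exact, (∀ x : X, U • U • x = x) → (∀ x, U • x ≠ x → x ∈ A) → U ∈ H)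
    (by
      refine ⟨MeasurableSet.empty, fun x y _ h => h, fun U _ h => ?_⟩
      convert one_mem H
      ext x
      rw [one_smul]
      exact by_contra fun h' => h x h')
    (fun A h => h.1)
    (fun A h hd => by
      refine ⟨MeasurableSet.iUnion fun n => (h n).1, fun x y hxy hx => ?_, fun U hU hUA => ?_⟩
      · obtain ⟨n, hn⟩ := mem_iUnion.1 hx
        exact mem_iUnion.2 ⟨n, (h n).2.1 x y hxy hn⟩
      · have h1 : ∀ n x, U • x ∈ A n ↔ x ∈ A n := fun n => (h n).2.1.smul_mem_iff U
        have h2 := hH.restr_iUnion_mem (T := U) (fun n => (h n).1) h1 (fun n =>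
          (h n).2.2 _ (restr_involutive hU (h n).1 (h1 n)) fun x hx => by_contra fun h' =>
            hx (restr_smul_of_notMem (h n).1 (h1 n) h')) hd
        have h3 : MeasurableSet (⋃ n, A n) := MeasurableSet.iUnion fun n => (h n).1
        have h4 : ∀ x, U • x ∈ ⋃ n, A n ↔ x ∈ ⋃ n, A n := fun x => by simp [h1]
        convert h2 using 1
        ext x
        by_cases hx : x ∈ ⋃ n, A n
        · rw [restr_smul_of_mem h3 h4 hx]
        · rw [restr_smul_of_notMem h3 h4 hx]
          exact by_contra fun h' => hx (hUA x h'))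
  refine ⟨A, hA, hAinv, ?_⟩
  ext t
  obtain ⟨T, hT, rfl⟩ := exists_rep t
  rw [← hmem hT, mem_derivedClosureOn]
  refine ⟨fun hTH => ?_, fun hTA => hH.mem_of_support hA hAinv hAH hT hTA⟩
  suffices h : μ ({x | T • x ≠ x} \ A) = 0 by
    filter_upwards [measure_eq_zero_iff_ae_notMem.1 h] with x hx hxT
    exact by_contra fun h => hx ⟨hxT, h⟩
  -- otherwise the saturation of a set moved off itself by `T` would contradict the choice of `A`
  by_contra h0
  obtain ⟨B, hBsub, hB, hB0, hBT⟩ := exists_subset_disjoint_images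
    ((measurableSet_support T).diff hA) h0 (measurable_smul T) measurable_id fun x hx => hx.1
  refine hB0 (measure_mono_null (subset_saturation (Φ := Φ) B) (hmax _
    ⟨measurableSet_saturation hB, invariant_saturation B, fun U hU hUB =>
      hH.involution_mem_of_saturation hap (fun U hU => involution_mem_derivedClosure hap hU) hnorm
        hTH hB (fun x hx h => hBT x hx _ h rfl) hU hUB⟩ (disjoint_left.2 ?_)))
  rintro x ⟨y, hy, hyx⟩ hxA
  exact (hBsub hy).2 (hAinv x y (Φ.orbitRel.symm hyx) hxA)

/-! ### Ergodicity and simplicity -/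

lemma nontrivial_derivedClosure [IsProbabilityMeasure μ] (hap : Φ.Aperiodic) :
    Nontrivial Φ.derivedClosure := by
  obtain ⟨U, hU, -, h0⟩ := exists_involution_ne hap MeasurableSet.univ (by simp)
  refine ⟨⟨⟨Φ.toFull U, involution_mem_derivedClosure hap hU⟩, 1, fun h => h0 ?_⟩⟩
  have h1 : Φ.toFull U = Φ.toFull 1 := by
    rw [map_one]
    exact congrArg Subtype.val h
  rw [toFull_eq_iff] at h1
  rw [measure_eq_zero_iff_ae_notMem]
  filter_upwards [h1] with x hx h
  exact h (by rwa [one_smul] at hx)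

lemma derivedClosureOn_eq_bot [IsFiniteMeasure μ] {A : Set X} (h : μ A = 0) :
    Φ.derivedClosureOn A = ⊥ := by
  refine (Subgroup.eq_bot_iff_forall _).2 fun t ht => ?_
  obtain ⟨T, hT, rfl⟩ := exists_rep t
  refine Subtype.ext ?_
  change Φ.toFull T = 1
  rw [← map_one Φ.toFull, toFull_eq_iff]
  filter_upwards [(mem_derivedClosureOn hT).1 ht, measure_eq_zero_iff_ae_notMem.1 h] with x h1 h2
  rw [one_smul]
  exact by_contra fun h => h2 (h1 h)

lemma derivedClosureOn_eq_top [IsFiniteMeasure μ] {A : Set X} (h : ∀ᵐ x ∂μ, x ∈ A) :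
    Φ.derivedClosureOn A = ⊤ := by
  refine (Subgroup.eq_top_iff' _).2 fun t => ?_
  obtain ⟨T, hT, rfl⟩ := exists_rep t
  exact (mem_derivedClosureOn hT).2 (h.mono fun x hx _ => hx)

theorem isErgodic_iff_topologicallySimple [IsProbabilityMeasure μ] (hap : Φ.Aperiodic) :
    Φ.IsErgodic ↔ TopologicallySimple Φ.derivedClosure := by
  constructor
  · refine fun herg => ⟨nontrivial_derivedClosure hap, fun N hN hNc => ?_⟩
    obtain ⟨A, hA, hinv, rfl⟩ := exists_eq_derivedClosureOn hap N hN hNc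
    by_cases h0 : μ A = 0
    · exact Or.inl (derivedClosureOn_eq_bot h0)
    · refine Or.inr (derivedClosureOn_eq_top ?_)
      filter_upwards [herg A hA h0] with x hx
      obtain ⟨y, hy, hyx⟩ := hx
      exact hinv y x hyx hy
  · intro hs A hA h0
    have hm : MeasurableSet (Φ.saturation A) := measurableSet_saturation hA
    rcases hs.2 _ (normal_derivedClosureOn (invariant_saturation A))
      (isClosed_derivedClosureOn hm) with h | h
    · refine absurd (measure_mono_null (subset_saturation (Φ := Φ) A) ?_) h0
      have := measure_diff_eq_zero_of_le hap hm MeasurableSet.empty (h.le.trans bot_le)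
      rwa [sdiff_empty] at this
    · have := measure_diff_eq_zero_of_le hap MeasurableSet.univ hm (le_top.trans h.ge)
      filter_upwards [measure_eq_zero_iff_ae_notMem.1 this] with x hx
      exact by_contra fun h => hx ⟨mem_univ x, h⟩

/-! ### Graphings generated by one transformation -/

section single

variable {T : X ≃ᵐ X} {hT : MeasurePreserving T μ μ}

omit [StandardBorelSpace X] in
lemma single_rel_iff {x y : X} : (single T hT).rel x y ↔ T x = y := by
  constructor
  · rintro ⟨φ, rfl, h, rfl⟩
    rfl
  · rintro rfl
    exact ⟨_, rfl, mem_univ x, rfl⟩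

omit [StandardBorelSpace X] in
lemma single_orbitRel_iff {x y : X} :
    (single T hT).orbitRel x y ↔ ∃ n : ℤ, ((T.toEquiv : Equiv.Perm X) ^ n) x = y := by
  constructor
  · intro h
    induction h with
    | rel x y h => exact ⟨1, by rw [zpow_one]; exact single_rel_iff.1 h⟩
    | refl x => exact ⟨0, rfl⟩
    | symm x y _ ih =>
      obtain ⟨n, rfl⟩ := ih
      exact ⟨-n, by rw [← Equiv.Perm.mul_apply, ← zpow_add, neg_add_cancel]; rfl⟩
    | trans x y z _ _ ih1 ih2 =>
      obtain ⟨n, rfl⟩ := ih1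
      obtain ⟨m, rfl⟩ := ih2
      exact ⟨m + n, by rw [zpow_add, Equiv.Perm.mul_apply]⟩
  · rintro ⟨n, rfl⟩
    have hstep : ∀ y : X, (single T hT).orbitRel y (T y) := fun y =>
      Relation.EqvGen.rel _ _ (single_rel_iff.2 rfl)
    induction n using Int.induction_on with
    | zero => exact (single T hT).orbitRel.refl x
    | succ n ih =>
      refine (single T hT).orbitRel.trans ih ?_
      rw [add_comm, zpow_add, zpow_one, Equiv.Perm.mul_apply]
      exact hstep _
    | pred n ih =>
      refine (single T hT).orbitRel.trans ih ((single T hT).orbitRel.symm ?_)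
      have := hstep (((T.toEquiv : Equiv.Perm X) ^ (-(n : ℤ) - 1)) x)
      convert this using 1
      change _ = (T.toEquiv : Equiv.Perm X) _
      rw [← Equiv.Perm.mul_apply, ← zpow_one_add]
      congr 2
      ring

omit [StandardBorelSpace X] in
lemma single_aperiodic_iff : (single T hT).Aperiodic ↔ AperiodicMap μ T := by
  refine eventually_congr (Eventually.of_forall fun x => ?_)
  rw [show {y | (single T hT).orbitRel x y} =
    range fun n : ℤ => ((T.toEquiv : Equiv.Perm X) ^ n) x from
      ext fun y => single_orbitRel_iff]

lemma single_isErgodic_iff [IsFiniteMeasure μ] : (single T hT).IsErgodic ↔ Ergodic T μ := by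
  have hinv : ∀ A : Set X, T ⁻¹' A = A ↔ (single T hT).Invariant A := by
    intro A
    constructor
    · intro h x y hxy hx
      have hmem : ∀ x, T x ∈ A ↔ x ∈ A := fun x => by
        conv_rhs => rw [← h]
        rfl
      have : x ∈ A ↔ y ∈ A := by
        clear hx
        induction hxy with
        | rel x y h => rw [← single_rel_iff.1 h, hmem]
        | refl x => rfl
        | symm x y _ ih => exact ih.symm
        | trans x y z _ _ ih1 ih2 => exact ih1.trans ih2
      exact this.1 hx
    · intro h
      ext x
      have hx : (single T hT).orbitRel x (T x) := Relation.EqvGen.rel _ _ (single_rel_iff.2 rfl)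
      exact ⟨h _ _ ((single T hT).orbitRel.symm hx), h _ _ hx⟩
  constructor
  · intro h
    refine ⟨hT, ⟨fun s hs hsT => ?_⟩⟩
    rw [eventuallyConst_set']
    by_cases h0 : μ s = 0
    · exact Or.inl (ae_eq_empty.2 h0)
    · refine Or.inr ?_
      filter_upwards [h s hs h0] with x hx
      obtain ⟨y, hy, hyx⟩ := hx
      exact propext ⟨fun _ => trivial, fun _ => (hinv s).1 hsT y x hyx hy⟩
  · intro h A hA h0
    have hm : MeasurableSet ((single T hT).saturation A) := measurableSet_saturation hA
    rcases h.toPreErgodic.ae_mem_or_ae_notMem hm ((hinv _).2 (invariant_saturation A)) with h1 | h1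
    · exact h1
    · exact absurd (measure_mono_null (subset_saturation A) (measure_eq_zero_iff_ae_notMem.2 h1)) h0

/-- An ergodic transformation of an atomless space is aperiodic. Otherwise the minimum of an orbit,
in a Borel linear order, would be an almost everywhere defined invariant function; hence almost all
the orbits would have the same minimum, and be one single orbit. -/
lemma aperiodicMap_of_ergodic [NullSingletonClass μ] (h : Ergodic T μ) : AperiodicMap μ T := by
  obtain ⟨f, hf⟩ := exists_measurableEmbedding_real X
  let P : Equiv.Perm X := T.toEquiv
  let S : PreAut μ := ⟨P, h.toMeasurePreserving, T.symm.measurable⟩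
  have hP : ∀ n : ℤ, MeasurePreserving (P ^ n : Equiv.Perm X) μ μ := fun n => (S ^ n).2.1
  let m : X → ℝ := fun x => ⨅ n : ℤ, f ((P ^ n) x)
  have hm : Measurable m := Measurable.iInf fun n => hf.measurable.comp (hP n).measurable
  have hmT : m ∘ T = m := by
    funext x
    change ⨅ n : ℤ, f ((P ^ n) (P x)) = ⨅ n : ℤ, f ((P ^ n) x)
    rw [← (Equiv.addRight (1 : ℤ)).iInf_comp (g := fun n : ℤ => f ((P ^ n) x))]
    refine iInf_congr fun n => ?_
    change _ = f ((P ^ (n + 1)) x)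
    rw [zpow_add_one, Equiv.Perm.mul_apply]
  obtain ⟨c, hc⟩ := h.toPreErgodic.ae_eq_const_of_ae_eq_comp hm hmT
  have h0 : ∀ᵐ x ∂μ, f x ≠ c := by
    have hs : (f ⁻¹' {c}).Subsingleton := subsingleton_singleton.preimage hf.injective
    exact measure_eq_zero_iff_ae_notMem.1 (hs.measure_zero μ)
  have h1 : ∀ᵐ x ∂μ, ∀ n : ℤ, f ((P ^ n) x) ≠ c :=
    ae_all_iff.2 fun n => (hP n).quasiMeasurePreserving.ae h0
  filter_upwards [hc, h1] with x hx hx' hfin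
  have hfin' : (range fun n : ℤ => f ((P ^ n) x)).Finite := by
    have := hfin.image f
    rwa [← range_comp] at this
  obtain ⟨n, hn⟩ := (range_nonempty fun n : ℤ => f ((P ^ n) x)).csInf_mem hfin'
  exact hx' n (hn.trans hx)

end single

end L1Full.Graphing

theorem mainTheorem4 {X : Type*} [MeasurableSpace X] [StandardBorelSpace X]
    (μ : Measure X) [IsProbabilityMeasure μ] [NullSingletonClass μ] :
    (∀ Φ : L1Full.Graphing μ, Φ.Aperiodic →
      (∀ N : Subgroup Φ.derivedClosure, N.Normal → IsClosed (N : Set Φ.derivedClosure) →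
        ∃ A : Set X, MeasurableSet A ∧ Φ.Invariant A ∧ N = Φ.derivedClosureOn A ∧
          ∀ B : Set X, MeasurableSet B → Φ.Invariant B → N = Φ.derivedClosureOn B →
            A =ᵐ[μ] B) ∧
      (Φ.IsErgodic ↔ L1Full.TopologicallySimple Φ.derivedClosure)) ∧
    (∀ (T : X ≃ᵐ X) (hT : MeasurePreserving T μ μ),
      (Ergodic T μ → L1Full.TopologicallySimple (L1Full.Graphing.single T hT).derivedClosure) ∧
      (L1Full.AperiodicMap μ T →
        L1Full.TopologicallySimple (L1Full.Graphing.single T hT).derivedClosure →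
          Ergodic T μ)) := by
  refine ⟨fun Φ hap => ⟨fun N hN hNc => ?_, L1Full.Graphing.isErgodic_iff_topologicallySimple hap⟩,
    fun T hT => ⟨fun herg => ?_, fun hap hs => ?_⟩⟩
  · obtain ⟨A, hA, hinv, hNA⟩ := L1Full.Graphing.exists_eq_derivedClosureOn hap N hN hNc
    exact ⟨A, hA, hinv, hNA, fun B hB _ hNB =>
      L1Full.Graphing.ae_eq_of_derivedClosureOn_eq hap hA hB (hNA.symm.trans hNB)⟩
  · have hap := L1Full.Graphing.single_aperiodic_iff (hT := hT) |>.2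
      (L1Full.Graphing.aperiodicMap_of_ergodic herg)
    exact (L1Full.Graphing.isErgodic_iff_topologicallySimple hap).1
      (L1Full.Graphing.single_isErgodic_iff.2 herg)
  · exact L1Full.Graphing.single_isErgodic_iff.1
      ((L1Full.Graphing.isErgodic_iff_topologicallySimple
        (L1Full.Graphing.single_aperiodic_iff.2 hap)).2 hs)
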